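/- Fix $q>0$ and $\eta>0$. \emph{Model.} Questions are points $x\in\mathbb R$; question $x$ has an answer $y(x)\in\mathbb R$. Knowledge is a nonempty finite set of answered questions $K=\{x_1<\dots<x_k\}$ with their answers. Given knowledge $K$, the conjecture about $y(x)$ is the normal law of a standard Brownian path through the known points: its mean interpolates the neighbouring known answers linearly (and is constant beyond $x_1$ and $x_k$), and its variance is $$\sigma^2_x(K)=\begin{cases}x_1-x,& x<x_1,\\ \dfrac{(x_{i+1}-x)(x-x_i)}{x_{i+1}-x_i},& x\in[x_i,x_{i+1}),\\ x-x_k,& x\ge x_k.\end{cases}$$ On every question $x$ a decision maker takes an action $a\in\mathbb R$ with payoff $1-(a-y(x))^2/q$, or an outside option with payoff $0$. The value $v(K)$ of knowledge is the integral over $x\in\mathbb R$ of her maximal expected payoff under the conjecture about $x$, and the benefit of discovering the answer to $x$ is $V(x;K)=v(K\cup\{x\})-v(K)$. A researcher who chooses $x\in\mathbb R$ and a success probability $\rho\in[0,1]$ obtains $$\rho\,V(x;K)-\eta\,\tilde c(\rho)\,\sigma_x^2(K),\qquad \tilde c(\rho)=(\mathrm{erf}^{-1}(\rho))^2 \text{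 for } \rho<1,\quad \tilde c(1)=\infty$$ (with $0\cdot\infty=0$). She expands knowledge if $x<x_1$ or $x>x_k$. The bounded areas of $K$ are the intervals $[x_i,x_{i+1})$, of length $x_{i+1}-x_i$. For an area of length $X\in(0,\infty)$, represented by $K=\{0,X\}$, let $U_R(X)$ be the researcher's maximal payoff over $d\in[0,X/2]$ and $\rho\in[0,1]$, where $d$ is the distance of her question $x=d$ from the endpoint $0$. Write $d(X),\rho(X)$ for optimal choices. \textbf{Proposition.} There are cutoffs, depending only on $q$ and $\eta$, $$2q<\widehat X<\dot X<\widecheck X<\widetilde X<8q,\qquad \dot X=\frac{8\cos(\pi/18)}{\sqrt3}\,q,$$ such that, for all answers $y$: \begin{enumerate} \item For every $K$ an optimal choice $(x,\rho)\in\mathbb R\times[0,1]$ exists. All optimal choices expand knowledge if and only if all bounded areas of $K$ are shorter than $\widehat X$; some optimal choice expands knowledge if and only if no bounded area is longer than $\widehat X$. \item For every $X\in(0,\infty)$ optimal choices $d(X),\rho(X)$ exist. For every selection of optimal choices, $d(\cdot)$ and $\rho(\cdot)$ are nonmonotone on $(0,\infty)$ (neither nondecreasing nor nonincreasing). The probability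 $\rho(\cdot)$ has its unique maximum at $\dot X$: $\rho(X)<\rho(\dot X)$ for all $X\neq\dot X$. The distance has its unique maximum at $\widetilde X$: $\widetilde X/2$ is an optimal distance at $\widetilde X$, and every optimal distance at any $X\ne\widetilde X$ is smaller than $\widetilde X/2$. \item $U_R$ is single peaked with maximum at $\widecheck X$: it is strictly increasing on $(0,\widecheck X]$ and strictly decreasing on $[\widecheck X,\infty)$. \end{enumerate} -/

import Mathlib

open Set MeasureTheory ProbabilityTheory

/-! Knowledge consists of a truth `y : ℝ → ℝ` (question `x` has the answer `y x`) together with the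
finite set `K` of questions whose answers are known. -/

namespace Knowledge

/-- The known questions weakly to the left of `x`. -/
noncomputable def leftOf (K : Finset ℝ) (x : ℝ) : Finset ℝ := K.filter (fun k => k ≤ x)

/-- The known questions strictly to the right of `x`. -/
noncomputable def rightOf (K : Finset ℝ) (x : ℝ) : Finset ℝ := K.filter (fun k => x < k)

open Classical in
/-- Mean of the conjecture about question `x`: linear interpolation between the two neighbouring
known answers, constant beyond the frontier (the value for empty knowledge is never used). -/
noncomputable def conjMean (y : ℝ → ℝ) (K : Finset ℝ) (x : ℝ) : ℝ :=
  if hl : (leftOf K x).Nonempty then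
    if hr : (rightOf K x).Nonempty then
      y ((leftOf K x).max' hl) +
        (x - (leftOf K x).max' hl) / ((rightOf K x).min' hr - (leftOf K x).max' hl) *
          (y ((rightOf K x).min' hr) - y ((leftOf K x).max' hl))
    else y ((leftOf K x).max' hl)
  else
    if hr : (rightOf K x).Nonempty then y ((rightOf K x).min' hr) else 0

open Classical in
/-- Variance of the conjecture about question `x`: that of a Brownian bridge between two
neighbouring known questions, and the distance to the frontier beyond it (the value for empty
knowledge is never used). -/
noncomputable def conjVar (K : Finset ℝ) (x : ℝ) : ℝ :=
  if hl : (leftOf K x).Nonempty then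
    if hr : (rightOf K x).Nonempty then
      ((rightOf K x).min' hr - x) * (x - (leftOf K x).max' hl) /
        ((rightOf K x).min' hr - (leftOf K x).max' hl)
    else x - (leftOf K x).max' hl
  else
    if hr : (rightOf K x).Nonempty then (rightOf K x).min' hr - x else 0

/-- The conjecture about question `x`: the conditional law of the answer when the truth is a
standard Brownian path through the known question-answer pairs. -/
noncomputable def conjecture (y : ℝ → ℝ) (K : Finset ℝ) (x : ℝ) : Measure ℝ :=
  gaussianReal (conjMean y K x) (conjVar K x).toNNReal

/-- The decision maker's payoff on a question with answer `t`, from the proactive action `some a`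
or from the outside option `none`. -/
noncomputable def decisionPayoff (q : ℝ) (act : Option ℝ) (t : ℝ) : ℝ :=
  match act with
  | none => 0
  | some a => 1 - (a - t) ^ 2 / q

/-- The value of knowledge: the decision maker's total expected payoff when she acts optimally on
every question, given her conjectures. -/
noncomputable def value (q : ℝ) (y : ℝ → ℝ) (K : Finset ℝ) : ℝ :=
  ∫ x, ⨆ act : Option ℝ, ∫ t, decisionPayoff q act t ∂(conjecture y K x)

/-- The benefit of discovering the answer to question `x`. -/
noncomputable def benefit (q : ℝ) (y : ℝ → ℝ) (K : Finset ℝ) (x : ℝ) : ℝ :=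
  value q y (insert x K) - value q y K

/-- `[a, b)` is a bounded area of the partition determined by the known questions. -/
def IsArea (K : Finset ℝ) (a b : ℝ) : Prop :=
  a ∈ K ∧ b ∈ K ∧ a < b ∧ ∀ k ∈ K, k ≤ a ∨ b ≤ k

/-- Question `x` lies strictly beyond the frontier, so answering it expands knowledge. -/
def Expands (K : Finset ℝ) (x : ℝ) : Prop :=
  (∀ k ∈ K, x < k) ∨ (∀ k ∈ K, k < x)

/-- The error function. -/
noncomputable def erf (t : ℝ) : ℝ :=
  2 / Real.sqrt Real.pi * ∫ s in (0 : ℝ)..t, Real.exp (-s ^ 2)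

/-- The cost factor: the squared inverse error function on `[0, 1)`, and `∞` at success
probability one. -/
noncomputable def costFactor (ρ : ℝ) : EReal :=
  if ρ < 1 then (((Function.invFun erf ρ) ^ 2 : ℝ) : EReal) else ⊤

/-- The researcher's payoff from question `x` and success probability `ρ`. -/
noncomputable def researcherPayoff (q η : ℝ) (y : ℝ → ℝ) (K : Finset ℝ) (x ρ : ℝ) : EReal :=
  ((ρ * benefit q y K x : ℝ) : EReal) - (η : EReal) * (costFactor ρ * (conjVar K x : EReal))

/-- `(x, ρ)` is an optimal choice of the researcher among the questions in `S` and the success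
probabilities in `[0, 1]`. -/
def IsOptimal (q η : ℝ) (y : ℝ → ℝ) (K : Finset ℝ) (S : Set ℝ) (x ρ : ℝ) : Prop :=
  x ∈ S ∧ ρ ∈ Icc (0 : ℝ) 1 ∧ ∀ x' ∈ S, ∀ ρ' ∈ Icc (0 : ℝ) 1,
    researcherPayoff q η y K x' ρ' ≤ researcherPayoff q η y K x ρ

/-- `(d, ρ)` is an optimal choice of distance and success probability in an area of length `X`.
The area is represented by `[0, X)`, where the question at distance `d ≤ X / 2` is `d` itself. -/
def IsOptimalInArea (q η : ℝ) (y : ℝ → ℝ) (X d ρ : ℝ) : Prop :=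
  IsOptimal q η y {0, X} (Icc 0 (X / 2)) d ρ

/-- The researcher's maximal payoff in an area of length `X`. -/
noncomputable def areaPayoff (q η : ℝ) (y : ℝ → ℝ) (X : ℝ) : EReal :=
  ⨆ d ∈ Icc 0 (X / 2), ⨆ ρ ∈ Icc (0 : ℝ) 1, researcherPayoff q η y {0, X} d ρ

end Knowledge

namespace Knowledge

/-! ### The error function -/

/-! The best action is the conjectured mean, so the answers drop out: a question contributes `max 0
(1 - conjVar K x / q)` to the value. Scaling reduces everything to `q = 1`. An area of length `x` is
then worth `x - x^2/6 + F x/6`, where `F = optionPart` vanishes up to `4` and equals `x^2 s^3`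
beyond, with `s = √(1 - 4/x)`.

For benefit `V` and variance `v`, the payoff after optimizing over the probability is `v * g (V /
v)`. Here `g = unitPayoff` is a maximum of affine functions of the ratio, hence convex, and its
slope is the optimal probability. The inequality `2t < √π exp(t^2) erf t` has two consequences that
carry the proof. First, at the optimum the payoff is `ρ (V - κ v)` with a price `κ < V / (2v)`;
since the same effort is available at any other question, comparing two questions reduces to a
linear inequality in `V` and `v` for all such `κ` (`questionPayoff_lt`). Second, `log g` is concave.

At the midpoint of an area the ratio `V / v` is concave in the length, so the log of the midpoint
payoff is strictly concave on `(0, 8]` and has one peak. The ratio itself peaks where `s^3 - 3s + 1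
= 0`, that is at `s = 2 sin(π/18)`; this is the third-cutoff-free constant `ratioPeak`. The payoff
peaks later, because the variance still grows there.

For the distance, `F'' > 2` beyond `4` and `F'' > 4` just beyond `4` exclude interior maxima at
distance `18/5` or more: the best distance is below `18/5` or is the midpoint of an area shorter
than `8` (`IsBestDistance.lt_or_eq`). Up to length `36/5` it is always the midpoint. Beyond that, a
fixed short distance loses benefit and gains variance as the area grows, so the best payoff keeps
falling. The distance peaks at the largest length with an optimal midpoint. The expansion cutoff is
where the best payoff in an area meets the best payoff beyond the frontier. Longer areas stay above
it, since in very long areas a short distance has at least the frontier's benefit and strictly less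
variance. -/

theorem hasDerivAt_erf (t : ℝ) :
    HasDerivAt erf (2 / √Real.pi * Real.exp (-t ^ 2)) t := by
  have hc : Continuous fun s : ℝ => Real.exp (-s ^ 2) := by fun_prop
  exact (intervalIntegral.integral_hasDerivAt_right (hc.intervalIntegrable _ _)
    hc.aestronglyMeasurable.stronglyMeasurableAtFilter hc.continuousAt).const_mul _

theorem continuous_erf : Continuous erf :=
  continuous_iff_continuousAt.2 fun t => (hasDerivAt_erf t).continuousAt

theorem erf_strictMono : StrictMono erf := by
  refine strictMono_of_deriv_pos fun t => ?_
  rw [(hasDerivAt_erf t).deriv]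
  have := Real.pi_pos
  positivity

@[simp] theorem erf_zero : erf 0 = 0 := by simp [erf]

theorem erf_nonneg {t : ℝ} (ht : 0 ≤ t) : 0 ≤ erf t := by
  simpa using erf_strictMono.monotone ht

theorem erf_pos {t : ℝ} (ht : 0 < t) : 0 < erf t := by
  simpa using erf_strictMono ht

theorem tendsto_erf_atTop : Filter.Tendsto erf Filter.atTop (nhds 1) := by
  have h := intervalIntegral_tendsto_integral_Ioi (μ := volume) (f := fun s : ℝ => Real.exp (-s ^ 2))
    0 (by simpa using (integrable_exp_neg_mul_sq (b := 1) one_pos).integrableOn) Filter.tendsto_id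
  have hI : ∫ s in Ioi (0 : ℝ), Real.exp (-s ^ 2) = √Real.pi / 2 := by
    simpa using integral_gaussian_Ioi 1
  rw [hI] at h
  have h2 := h.const_mul (2 / √Real.pi)
  have hs : 0 < √Real.pi := Real.sqrt_pos.2 Real.pi_pos
  have : 2 / √Real.pi * (√Real.pi / 2) = 1 := by field_simp
  rw [this] at h2
  exact h2

theorem erf_lt_one (t : ℝ) : erf t < 1 :=
  (erf_strictMono (lt_add_one t)).trans_le
    (erf_strictMono.monotone.ge_of_tendsto tendsto_erf_atTop _)

theorem exists_erf_eq {ρ : ℝ} (h0 : 0 ≤ ρ) (h1 : ρ < 1) : ∃ t, 0 ≤ t ∧ erf t = ρ := by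
  obtain ⟨b, hb, hb0⟩ := ((tendsto_erf_atTop.eventually (lt_mem_nhds h1)).and
    (Filter.eventually_ge_atTop 0)).exists
  obtain ⟨t, ht, rfl⟩ := intermediate_value_Icc hb0 continuous_erf.continuousOn
    ⟨by simpa using h0, hb.le⟩
  exact ⟨t, ht.1, rfl⟩

theorem invFun_erf (t : ℝ) : Function.invFun erf (erf t) = t :=
  Function.leftInverse_invFun erf_strictMono.injective t

/-- The difference `erf u - 2/√π * u * exp(-u^2)` vanishes at `0` and has derivative `2/√π * 2u^2
exp(-u^2)`. This is the only quantitative fact about `erf` needed: it bounds the price of variance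
and gives log-concavity of `unitPayoff`. -/
theorem mul_exp_lt_erf {t : ℝ} (ht : 0 < t) :
    2 * t < √Real.pi * Real.exp (t ^ 2) * erf t := by
  have hs : 0 < √Real.pi := Real.sqrt_pos.2 Real.pi_pos
  have hd : ∀ u : ℝ, HasDerivAt (fun u => erf u - 2 / √Real.pi * (u * Real.exp (-u ^ 2)))
      (2 / √Real.pi * (2 * u ^ 2 * Real.exp (-u ^ 2))) u := by
    intro u
    have h1 : HasDerivAt (fun u : ℝ => Real.exp (-u ^ 2)) (Real.exp (-u ^ 2) * -(2 * u)) u := by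
      simpa using ((hasDerivAt_id u).pow 2).neg.exp
    have h2 := (hasDerivAt_erf u).sub (((hasDerivAt_id u).mul h1).const_mul (2 / √Real.pi))
    refine h2.congr_deriv ?_
    simp only [id]; ring
  have hm : StrictMonoOn (fun u => erf u - 2 / √Real.pi * (u * Real.exp (-u ^ 2))) (Ici 0) := by
    refine strictMonoOn_of_deriv_pos (convex_Ici 0)
      (fun u _ => (hd u).continuousAt.continuousWithinAt) fun u hu => ?_
    rw [interior_Ici] at hu
    rw [(hd u).deriv]
    have := mem_Ioi.1 hu
    positivity
  have h := hm self_mem_Ici ht.le ht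
  simp only [erf_zero, zero_mul, mul_zero, sub_zero, Real.exp_neg] at h
  have he : 0 < Real.exp (t ^ 2) := Real.exp_pos _
  have : 2 / √Real.pi * (t * (Real.exp (t ^ 2))⁻¹) < erf t := by linarith
  have h3 := mul_lt_mul_of_pos_left this (mul_pos hs he)
  calc 2 * t = √Real.pi * Real.exp (t ^ 2) * (2 / √Real.pi * (t * (Real.exp (t ^ 2))⁻¹)) := by
        field_simp
    _ < _ := h3

/-! ### The optimal success probability -/

/-- The benefit-variance ratio at which `erf t` is the optimal success probability. -/
noncomputable def focRatio (η t : ℝ) : ℝ := η * (√Real.pi * t * Real.exp (t ^ 2))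

/-- The inverse error function at the optimal success probability, as a function of the ratio of
benefit to variance. -/
noncomputable def effort (η r : ℝ) : ℝ := Function.invFun (focRatio η) (max r 0)

/-- The researcher's maximal payoff per unit of variance, as a function of the ratio of benefit to
variance. -/
noncomputable def unitPayoff (η r : ℝ) : ℝ := r * erf (effort η r) - η * effort η r ^ 2

variable {η : ℝ}

theorem continuous_focRatio : Continuous (focRatio η) := by
  unfold focRatio; fun_prop

theorem focRatio_strictMonoOn (hη : 0 < η) : StrictMonoOn (focRatio η) (Ici 0) := by
  intro a ha b hb hab
  have ha' := mem_Ici.1 ha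
  have hs : 0 < √Real.pi := Real.sqrt_pos.2 Real.pi_pos
  unfold focRatio
  have : Real.exp (a ^ 2) ≤ Real.exp (b ^ 2) := Real.exp_le_exp.2 (by gcongr)
  have h2 : √Real.pi * a < √Real.pi * b := by gcongr
  have h3 : √Real.pi * a * Real.exp (a ^ 2) < √Real.pi * b * Real.exp (b ^ 2) :=
    mul_lt_mul h2 this (Real.exp_pos _) (by nlinarith)
  gcongr

theorem focRatio_neg (t : ℝ) : focRatio η (-t) = - focRatio η t := by
  simp [focRatio]

@[simp] theorem focRatio_zero : focRatio η 0 = 0 := by simp [focRatio]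

theorem focRatio_injective (hη : 0 < η) : Function.Injective (focRatio η) := by
  have h : StrictMono (focRatio η) := by
    have h1 := focRatio_strictMonoOn hη
    refine StrictMonoOn.Iic_union_Ici (a := 0) ?_ h1
    intro a ha b hb hab
    have := h1 (a := -b) (b := -a) (by simpa using hb) (by simpa using ha) (by linarith)
    rw [focRatio_neg, focRatio_neg] at this
    linarith
  exact h.injective

theorem exists_focRatio_eq (hη : 0 < η) {r : ℝ} (hr : 0 ≤ r) : ∃ t, 0 ≤ t ∧ focRatio η t = r := by
  have hs : 1 ≤ √Real.pi := by
    rw [Real.one_le_sqrt]; linarith [Real.pi_gt_three]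
  have hb : 0 ≤ r / η := by positivity
  -- The upper end `r / η` works because both `√π` and the exponential are at least `1`.
  have h1 : r ≤ focRatio η (r / η) := by
    unfold focRatio
    have : 1 ≤ Real.exp ((r / η) ^ 2) := Real.one_le_exp (by positivity)
    have h2 : r / η ≤ √Real.pi * (r / η) * Real.exp ((r / η) ^ 2) := by
      nlinarith [mul_le_mul_of_nonneg_right hs hb, mul_le_mul_of_nonneg_left this
        (mul_nonneg (zero_le_one.trans hs) hb)]
    calc r = η * (r / η) := by field_simp
      _ ≤ _ := by gcongr
  obtain ⟨t, ht, h⟩ := intermediate_value_Icc hb (continuous_focRatio (η := η)).continuousOn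
    ⟨by simpa using hr, h1⟩
  exact ⟨t, ht.1, h⟩

theorem effort_spec (hη : 0 < η) (r : ℝ) :
    0 ≤ effort η r ∧ focRatio η (effort η r) = max r 0 := by
  obtain ⟨t, ht, h⟩ := exists_focRatio_eq hη (le_max_right r 0)
  have : effort η r = t := by
    rw [effort, ← h]
    exact Function.leftInverse_invFun (focRatio_injective hη) t
  rw [this]
  exact ⟨ht, h⟩

theorem effort_nonneg (hη : 0 < η) (r : ℝ) : 0 ≤ effort η r := (effort_spec hη r).1

theorem focRatio_effort (hη : 0 < η) {r : ℝ} (hr : 0 ≤ r) : focRatio η (effort η r) = r := by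
  rw [(effort_spec hη r).2, max_eq_left hr]

theorem effort_of_nonpos (hη : 0 < η) {r : ℝ} (hr : r ≤ 0) : effort η r = 0 := by
  apply focRatio_injective hη
  rw [(effort_spec hη r).2, max_eq_right hr, focRatio_zero]

theorem effort_focRatio (hη : 0 < η) {t : ℝ} (ht : 0 ≤ t) : effort η (focRatio η t) = t := by
  apply focRatio_injective hη
  rw [focRatio_effort hη]
  simpa using (focRatio_strictMonoOn hη).monotoneOn self_mem_Ici ht ht

theorem effort_strictMonoOn (hη : 0 < η) : StrictMonoOn (effort η) (Ici 0) := by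
  intro a ha b hb hab
  rw [← focRatio_effort hη ha, ← focRatio_effort hη hb] at hab
  exact ((focRatio_strictMonoOn hη).lt_iff_lt (effort_nonneg hη a) (effort_nonneg hη b)).1 hab

theorem effort_pos (hη : 0 < η) {r : ℝ} (hr : 0 < r) : 0 < effort η r := by
  have := effort_strictMonoOn hη self_mem_Ici hr.le hr
  rwa [effort_of_nonpos hη le_rfl] at this

theorem hasDerivAt_payoff (η r t : ℝ) : HasDerivAt (fun t => r * erf t - η * t ^ 2)
    (2 / √Real.pi * Real.exp (-t ^ 2) * (r - focRatio η t)) t := by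
  have h := ((hasDerivAt_erf t).const_mul r).sub (((hasDerivAt_id t).pow 2).const_mul η)
  refine h.congr_deriv ?_
  have hs : 0 < √Real.pi := Real.sqrt_pos.2 Real.pi_pos
  simp only [id, focRatio, Real.exp_neg]
  field_simp
  simp only [Nat.cast_ofNat, Nat.add_one_sub_one, pow_one]
  ring

/-- The derivative in `t` has the sign of `r - focRatio η t`, and `focRatio` is increasing, so the
payoff rises strictly up to `effort η r` and falls strictly afterwards. For `r ≤ 0` both terms are
nonpositive and the optimum is `0`. -/
theorem payoff_lt_unitPayoff (hη : 0 < η) {r t : ℝ} (ht : 0 ≤ t) (hne : t ≠ effort η r) :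
    r * erf t - η * t ^ 2 < unitPayoff η r := by
  have hs : 0 < √Real.pi := Real.sqrt_pos.2 Real.pi_pos
  rcases le_total r 0 with hr | hr
  · rw [effort_of_nonpos hη hr] at hne
    rw [unitPayoff, effort_of_nonpos hη hr]
    have h0 : 0 < t := lt_of_le_of_ne ht hne.symm
    have := erf_pos h0
    have h2 : 0 < η * t ^ 2 := by positivity
    simp only [erf_zero]
    nlinarith
  · have hT := focRatio_effort hη hr
    have hT0 := effort_nonneg hη r
    have hmono := focRatio_strictMonoOn hη
    rcases lt_or_gt_of_ne hne with hlt | hlt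
    · have h : StrictMonoOn (fun t => r * erf t - η * t ^ 2) (Icc 0 (effort η r)) := by
        refine strictMonoOn_of_deriv_pos (convex_Icc _ _)
          (fun u _ => (hasDerivAt_payoff η r u).continuousAt.continuousWithinAt) fun u hu => ?_
        rw [interior_Icc] at hu
        rw [(hasDerivAt_payoff η r u).deriv]
        have := hmono (mem_Ici.2 hu.1.le) hT0 hu.2
        rw [hT] at this
        have : 0 < r - focRatio η u := by linarith
        positivity
      exact h ⟨ht, hlt.le⟩ ⟨hT0, le_rfl⟩ hlt
    · have h : StrictAntiOn (fun t => r * erf t - η * t ^ 2) (Ici (effort η r)) := by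
        refine strictAntiOn_of_deriv_neg (convex_Ici _)
          (fun u _ => (hasDerivAt_payoff η r u).continuousAt.continuousWithinAt) fun u hu => ?_
        rw [interior_Ici] at hu
        rw [(hasDerivAt_payoff η r u).deriv]
        have := hmono hT0 (mem_Ici.2 (hT0.trans (mem_Ioi.1 hu).le)) hu
        rw [hT] at this
        have : r - focRatio η u < 0 := by linarith
        exact mul_neg_of_pos_of_neg (by positivity) this
      exact h self_mem_Ici hlt.le hlt

theorem payoff_le_unitPayoff (hη : 0 < η) (r : ℝ) {t : ℝ} (ht : 0 ≤ t) :
    r * erf t - η * t ^ 2 ≤ unitPayoff η r := by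
  by_cases h : t = effort η r
  · rw [h, unitPayoff]
  · exact (payoff_lt_unitPayoff hη ht h).le

theorem unitPayoff_nonneg (hη : 0 < η) (r : ℝ) : 0 ≤ unitPayoff η r := by
  simpa using payoff_le_unitPayoff hη r le_rfl

theorem unitPayoff_of_nonpos (hη : 0 < η) {r : ℝ} (hr : r ≤ 0) : unitPayoff η r = 0 := by
  simp [unitPayoff, effort_of_nonpos hη hr]

theorem unitPayoff_pos (hη : 0 < η) {r : ℝ} (hr : 0 < r) : 0 < unitPayoff η r := by
  simpa using payoff_lt_unitPayoff hη le_rfl (effort_pos hη hr).ne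

/-- The success probability at the optimum is a subgradient of the payoff per unit of variance. -/
theorem unitPayoff_subgradient (hη : 0 < η) (r r' : ℝ) :
    unitPayoff η r + erf (effort η r) * (r' - r) ≤ unitPayoff η r' := by
  have := payoff_le_unitPayoff hη r' (effort_nonneg hη r)
  rw [unitPayoff]; linarith

theorem unitPayoff_strictMonoOn (hη : 0 < η) : StrictMonoOn (unitPayoff η) (Ici 0) := by
  intro a ha b hb hab
  rcases eq_or_lt_of_le (mem_Ici.1 ha) with h | h
  · rw [← h, unitPayoff_of_nonpos hη le_rfl]
    exact unitPayoff_pos hη (h ▸ hab)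
  · have := unitPayoff_subgradient hη a b
    have := mul_pos (erf_pos (effort_pos hη h)) (sub_pos.2 hab)
    linarith

theorem unitPayoff_le_self (hη : 0 < η) {r : ℝ} (hr : 0 ≤ r) : unitPayoff η r ≤ r := by
  have h1 := erf_lt_one (effort η r)
  have : 0 ≤ η * effort η r ^ 2 := by positivity
  rw [unitPayoff]; nlinarith

/-- The subgradients are success probabilities, hence lie in `[0, 1)`. -/
theorem abs_unitPayoff_sub_le (hη : 0 < η) (r r' : ℝ) :
    |unitPayoff η r - unitPayoff η r'| ≤ |r - r'| := by
  have key : ∀ a b : ℝ, unitPayoff η a - unitPayoff η b ≤ |a - b| := by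
    intro a b
    have h := unitPayoff_subgradient hη a b
    have h1 := erf_lt_one (effort η a)
    have h0 := erf_nonneg (effort_nonneg hη a)
    have : erf (effort η a) * (a - b) ≤ |a - b| := by
      calc _ ≤ erf (effort η a) * |a - b| := by gcongr; exact le_abs_self _
        _ ≤ 1 * |a - b| := by gcongr
        _ = _ := one_mul _
    linarith
  rw [abs_le]
  constructor
  · have := key r' r; rw [abs_sub_comm] at this; linarith
  · exact key r r'

theorem continuous_unitPayoff (hη : 0 < η) : Continuous (unitPayoff η) := by
  refine (LipschitzWith.of_dist_le_mul (K := 1) fun a b => ?_).continuous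
  simpa [Real.dist_eq] using abs_unitPayoff_sub_le hη a b

theorem continuousAt_effort (hη : 0 < η) {r : ℝ} (hr : 0 < r) : ContinuousAt (effort η) r := by
  refine (effort_strictMonoOn hη).continuousAt_of_image_mem_nhds (Ici_mem_nhds hr) ?_
  refine Filter.mem_of_superset (Ioi_mem_nhds (effort_pos hη hr)) fun t ht => ?_
  refine ⟨focRatio η t, ?_, effort_focRatio hη (le_of_lt ht)⟩
  simpa using (focRatio_strictMonoOn hη).monotoneOn self_mem_Ici (mem_Ici.2 (le_of_lt ht)) (le_of_lt ht)

/-- Envelope theorem. The subgradient inequalities at `r` and at `r'` squeeze the first-order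
remainder between `0` and the change of subgradient times `r' - r`, which is `o(r' - r)` because the
optimal effort is continuous. -/
theorem hasDerivAt_unitPayoff (hη : 0 < η) {r : ℝ} (hr : 0 < r) :
    HasDerivAt (unitPayoff η) (erf (effort η r)) r := by
  rw [hasDerivAt_iff_isLittleO]
  have hc : ContinuousAt (fun r => erf (effort η r)) r :=
    continuous_erf.continuousAt.comp (continuousAt_effort hη hr)
  have ho : (fun r' => erf (effort η r') - erf (effort η r)) =o[nhds r] fun _ => (1 : ℝ) := by
    rw [Asymptotics.isLittleO_one_iff]
    simpa using hc.tendsto.sub_const (erf (effort η r))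
  have h2 := ho.mul_isBigO (Asymptotics.isBigO_refl (fun r' => r' - r) (nhds r))
  simp only [one_mul] at h2
  refine (Asymptotics.IsBigO.of_bound 1 (Filter.Eventually.of_forall fun r' => ?_)).trans_isLittleO h2
  have h3 := unitPayoff_subgradient hη r r'
  have h4 := unitPayoff_subgradient hη r' r
  rw [one_mul, Real.norm_eq_abs, Real.norm_eq_abs, smul_eq_mul, abs_of_nonneg (by linarith)]
  refine le_trans ?_ (le_abs_self _)
  linarith

/-- This is the reciprocal of the logarithmic derivative of `unitPayoff`. In terms of the effort `t`
it equals `η (√π t exp(t^2) - t^2 / erf t)`. Between efforts `t1 ≤ t2` the subtracted term grows by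
at most `(t2^2 - t1^2) / erf t2`, and `mul_exp_lt_erf` with `t1 + t2 ≤ 2 t2` bounds that by the
growth of the first term. -/
theorem unitPayoff_div_erf_monotoneOn (hη : 0 < η) :
    MonotoneOn (fun r => unitPayoff η r / erf (effort η r)) (Ioi 0) := by
  intro r1 hr1 r2 hr2 h12
  have hs : 0 < √Real.pi := Real.sqrt_pos.2 Real.pi_pos
  have key : ∀ r, 0 < r → unitPayoff η r / erf (effort η r) =
      η * (√Real.pi * effort η r * Real.exp (effort η r ^ 2) - effort η r ^ 2 / erf (effort η r)) := by
    intro r hr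
    have := (erf_pos (effort_pos hη hr)).ne'
    have hf := focRatio_effort hη hr.le
    rw [unitPayoff, sub_div, mul_div_assoc, div_self this, mul_one]
    conv_lhs => rw [← hf]
    rw [effort_focRatio hη (effort_nonneg hη r), focRatio]; ring
  simp only
  rw [key r1 hr1, key r2 hr2]
  have ht1 := effort_pos hη hr1
  have ht2 := effort_pos hη hr2
  have ht : effort η r1 ≤ effort η r2 :=
    (effort_strictMonoOn hη).monotoneOn (mem_Ici.2 (le_of_lt hr1)) (mem_Ici.2 (le_of_lt hr2)) h12
  set t1 := effort η r1
  set t2 := effort η r2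
  gcongr η * ?_
  have he1 := erf_pos ht1
  have he2 := erf_pos ht2
  have he : erf t1 ≤ erf t2 := erf_strictMono.monotone ht
  have hexp : Real.exp (t1 ^ 2) ≤ Real.exp (t2 ^ 2) := Real.exp_le_exp.2 (by gcongr)
  have h1 : t1 ^ 2 / erf t2 ≤ t1 ^ 2 / erf t1 := by gcongr
  have h2 : (t2 ^ 2 - t1 ^ 2) / erf t2 ≤ √Real.pi * (t2 - t1) * Real.exp (t2 ^ 2) := by
    rw [div_le_iff₀ he2]
    have h3 := mul_exp_lt_erf ht2
    nlinarith [mul_le_mul_of_nonneg_left h3.le (sub_nonneg.2 ht), mul_nonneg (sub_nonneg.2 ht) ht1.le]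
  have h4 : √Real.pi * t1 * Real.exp (t1 ^ 2) ≤ √Real.pi * t1 * Real.exp (t2 ^ 2) := by gcongr
  rw [sub_div] at h2
  nlinarith

theorem log_unitPayoff_concaveOn (hη : 0 < η) :
    ConcaveOn ℝ (Ioi 0) fun r => Real.log (unitPayoff η r) := by
  have hd : ∀ r ∈ Ioi (0 : ℝ), HasDerivAt (fun r => Real.log (unitPayoff η r))
      (erf (effort η r) / unitPayoff η r) r := fun r hr =>
    (hasDerivAt_unitPayoff hη hr).log (unitPayoff_pos hη hr).ne'
  refine AntitoneOn.concaveOn_of_deriv (convex_Ioi 0)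
    (fun r hr => (hd r hr).continuousAt.continuousWithinAt) ?_ ?_
  · rw [interior_Ioi]; exact fun r hr => (hd r hr).differentiableAt.differentiableWithinAt
  · rw [interior_Ioi]
    intro a ha b hb hab
    rw [(hd a ha).deriv, (hd b hb).deriv, ← inv_div, ← inv_div (unitPayoff η a)]
    have := unitPayoff_div_erf_monotoneOn hη ha hb hab
    have h0 : 0 < unitPayoff η a / erf (effort η a) :=
      div_pos (unitPayoff_pos hη ha) (erf_pos (effort_pos hη ha))
    exact inv_anti₀ h0 this

/-! ### Payoff comparisons between questions -/

/-- The maximal payoff over success probabilities from a question with benefit `V` and variance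
`v`. -/
noncomputable def questionPayoff (η V v : ℝ) : ℝ := v * unitPayoff η (V / v)

theorem questionPayoff_nonneg (hη : 0 < η) {V v : ℝ} (hv : 0 ≤ v) : 0 ≤ questionPayoff η V v :=
  mul_nonneg hv (unitPayoff_nonneg hη _)

theorem questionPayoff_pos (hη : 0 < η) {V v : ℝ} (hV : 0 < V) (hv : 0 < v) :
    0 < questionPayoff η V v :=
  mul_pos hv (unitPayoff_pos hη (div_pos hV hv))

theorem benefit_pos_of_questionPayoff_pos (hη : 0 < η) {V v : ℝ} (hv : 0 ≤ v)
    (h : 0 < questionPayoff η V v) : 0 < V ∧ 0 < v := by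
  have hv' : 0 < v := lt_of_le_of_ne hv fun h' => by simp [questionPayoff, ← h'] at h
  refine ⟨?_, hv'⟩
  by_contra hV
  rw [questionPayoff, unitPayoff_of_nonpos hη (div_nonpos_of_nonpos_of_nonneg (not_lt.1 hV) hv)] at h
  simp at h

theorem questionPayoff_le (hη : 0 < η) {V v : ℝ} (hV : 0 ≤ V) (hv : 0 ≤ v) :
    questionPayoff η V v ≤ V := by
  rcases eq_or_lt_of_le hv with h | h
  · simpa [questionPayoff, ← h] using hV
  · calc v * unitPayoff η (V / v) ≤ v * (V / v) := by
          gcongr; exact unitPayoff_le_self hη (by positivity)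
      _ = V := by field_simp

theorem le_questionPayoff (hη : 0 < η) {V v t : ℝ} (hv : 0 < v) (ht : 0 ≤ t) :
    erf t * V - η * t ^ 2 * v ≤ questionPayoff η V v := by
  have := mul_le_mul_of_nonneg_left (payoff_le_unitPayoff hη (V / v) ht) hv.le
  calc _ = v * (V / v * erf t - η * t ^ 2) := by field_simp
    _ ≤ _ := this

/-- At the optimal success probability the payoff is a positive multiple of benefit minus `κ` times
variance, where `κ` is at most half the benefit-variance ratio. -/
theorem exists_price (hη : 0 < η) {V v : ℝ} (hV : 0 < V) (hv : 0 < v) :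
    ∃ ρ κ : ℝ, 0 < ρ ∧ 0 < κ ∧ κ < V / (2 * v) ∧ questionPayoff η V v = ρ * (V - κ * v) ∧
      ∀ V' v', 0 < v' → ρ * (V' - κ * v') ≤ questionPayoff η V' v' := by
  have hr : 0 < V / v := div_pos hV hv
  set t := effort η (V / v) with ht
  have ht0 : 0 < t := effort_pos hη hr
  have he := erf_pos ht0
  refine ⟨erf t, η * t ^ 2 / erf t, he, by positivity, ?_, ?_, ?_⟩
  · have hf : focRatio η t = V / v := focRatio_effort hη hr.le
    have : V / (2 * v) = focRatio η t / 2 := by rw [hf]; field_simp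
    -- After clearing `erf t`, the bound is `mul_exp_lt_erf` multiplied by `η t`.
    rw [this, div_lt_iff₀ he, focRatio]
    nlinarith [mul_lt_mul_of_pos_left (mul_exp_lt_erf ht0) (mul_pos hη ht0)]
  · rw [questionPayoff, unitPayoff, ← ht]; field_simp
  · intro V' v' hv'
    refine le_trans (le_of_eq ?_) (le_questionPayoff hη (V := V') hv' ht0.le)
    field_simp

/-- The effort that is optimal for the second question is also available for the first, so a
comparison at the price of the second suffices. Only the range of that price is known, hence the
hypothesis over all `κ`. This keeps `erf` and `η` out of the later payoff comparisons. -/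
theorem questionPayoff_lt (hη : 0 < η) {V₁ v₁ V₂ v₂ : ℝ} (h₁ : 0 < v₁) (h₂ : 0 < v₂) (hV : 0 < V₂)
    (h : ∀ κ, 0 < κ → κ < V₂ / (2 * v₂) → V₂ - κ * v₂ < V₁ - κ * v₁) :
    questionPayoff η V₂ v₂ < questionPayoff η V₁ v₁ := by
  obtain ⟨ρ, κ, hρ, hκ, hκ', he, hle⟩ := exists_price hη hV h₂
  rw [he]
  exact (mul_lt_mul_of_pos_left (h κ hκ hκ') hρ).trans_le (hle V₁ v₁ h₁)

theorem questionPayoff_lt_of_lt (hη : 0 < η) {V₁ v₁ V₂ v₂ : ℝ} (h₁ : 0 < v₁) (hV : 0 < V₂)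
    (hVV : V₂ ≤ V₁) (hvv : v₁ < v₂) : questionPayoff η V₂ v₂ < questionPayoff η V₁ v₁ := by
  refine questionPayoff_lt hη h₁ (h₁.trans hvv) hV fun κ hκ _ => ?_
  nlinarith

/-! ### The value of an area, with `q = 1` -/

/-- The square root of `1 - 4 / x`, which is zero for areas of length `x ≤ 4`. -/
noncomputable def rootPart (x : ℝ) : ℝ := √(1 - 4 / x)

/-- Six times the value saved by the outside option in an area of length `x`. -/
noncomputable def optionPart (x : ℝ) : ℝ := x * (x - 4) * rootPart x

/-- The derivative of `optionPart`. -/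
noncomputable def optionSlope (x : ℝ) : ℝ := 2 * (x - 1) * rootPart x

theorem rootPart_of_le {x : ℝ} (h0 : 0 < x) (h : x ≤ 4) : rootPart x = 0 := by
  rw [rootPart, Real.sqrt_eq_zero']
  have : 1 ≤ 4 / x := by rwa [le_div_iff₀ h0, one_mul]
  linarith

theorem rootPart_nonneg (x : ℝ) : 0 ≤ rootPart x := Real.sqrt_nonneg _

theorem rootPart_sq {x : ℝ} (h : 4 ≤ x) : rootPart x ^ 2 = 1 - 4 / x := by
  rw [rootPart, Real.sq_sqrt]
  have : 4 / x ≤ 1 := by rw [div_le_one (by linarith)]; exact h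
  linarith

theorem rootPart_pos {x : ℝ} (h : 4 < x) : 0 < rootPart x := by
  apply Real.sqrt_pos.2
  have : 4 / x < 1 := by rw [div_lt_one (by linarith)]; exact h
  linarith

theorem rootPart_lt_one {x : ℝ} (h : 0 < x) : rootPart x < 1 := by
  rw [rootPart, Real.sqrt_lt' one_pos]
  have : 0 < 4 / x := by positivity
  linarith

/-- With `s = rootPart x` as the parameter, every expression in `x` and the square root becomes
rational in `s`. The numerical cutoffs below are lengths with rational `s`, such as `25/6`,
`100/21`, `25/4` and `36/5`. -/
theorem eq_of_rootPart {x : ℝ} (h : 4 ≤ x) : x = 4 / (1 - rootPart x ^ 2) := by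
  rw [rootPart_sq h]
  have : (0 : ℝ) < x := by linarith
  field_simp
  ring

theorem mul_one_sub_rootPart_sq {x : ℝ} (h : 4 ≤ x) : x * (1 - rootPart x ^ 2) = 4 := by
  rw [rootPart_sq h]
  have : (0 : ℝ) < x := by linarith
  field_simp
  ring

theorem rootPart_eq {s : ℝ} (h0 : 0 ≤ s) : rootPart (4 / (1 - s ^ 2)) = s := by
  rw [rootPart, div_div_cancel₀ four_ne_zero, sub_sub_cancel, Real.sqrt_sq h0]

theorem rootPart_mono {x y : ℝ} (h0 : 0 < x) (h : x ≤ y) : rootPart x ≤ rootPart y := by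
  apply Real.sqrt_le_sqrt
  gcongr

theorem optionPart_of_le {x : ℝ} (h0 : 0 ≤ x) (h : x ≤ 4) : optionPart x = 0 := by
  rcases eq_or_lt_of_le h0 with h' | h'
  · simp [optionPart, ← h']
  · simp [optionPart, rootPart_of_le h' h]

theorem optionPart_eq {x : ℝ} (h : 4 ≤ x) : optionPart x = x ^ 2 * rootPart x ^ 3 := by
  have h1 := mul_one_sub_rootPart_sq h
  rw [optionPart]
  linear_combination x * rootPart x * (h1)

theorem optionPart_nonneg {x : ℝ} (h0 : 0 ≤ x) : 0 ≤ optionPart x := by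
  rcases le_total x 4 with h | h
  · rw [optionPart_of_le h0 h]
  · have := rootPart_nonneg x
    rw [optionPart_eq h]; positivity

theorem optionSlope_of_le {x : ℝ} (h0 : 0 < x) (h : x ≤ 4) : optionSlope x = 0 := by
  simp [optionSlope, rootPart_of_le h0 h]

theorem continuousAt_rootPart {x : ℝ} (h0 : 0 < x) : ContinuousAt rootPart x := by
  unfold rootPart
  have := h0.ne'
  fun_prop (disch := assumption)

theorem hasDerivAt_rootPart {x : ℝ} (h : 4 < x) :
    HasDerivAt rootPart (2 / (x ^ 2 * rootPart x)) x := by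
  have hx : x ≠ 0 := by linarith
  have hr := rootPart_pos h
  have h1 : HasDerivAt (fun x : ℝ => 1 - 4 / x) (4 / x ^ 2) x := by
    have := ((hasDerivAt_inv hx).const_mul 4).const_sub 1
    refine this.congr_deriv ?_
    field_simp
  have h2 := h1.sqrt (by have := Real.sqrt_pos.1 hr; exact this.ne')
  refine h2.congr_deriv ?_
  rw [← rootPart]
  field_simp
  norm_num

theorem hasDerivAt_optionPart {x : ℝ} (h0 : 0 < x) :
    HasDerivAt optionPart (optionSlope x) x := by
  rcases lt_trichotomy x 4 with h | h | h
  · rw [optionSlope_of_le h0 h.le]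
    refine (hasDerivAt_const x (0 : ℝ)).congr_of_eventuallyEq ?_
    filter_upwards [Ioo_mem_nhds h0 h] with y hy
    exact optionPart_of_le hy.1.le hy.2.le
  · rw [optionSlope_of_le h0 h.le, hasDerivAt_iff_tendsto_slope]
    subst h
    -- At the junction `4` the difference quotient is exactly `y * rootPart y`, which tends to `0`.
    have hc : ContinuousAt (fun x => x * rootPart x) 4 :=
      continuousAt_id.mul (continuousAt_rootPart h0)
    have ht := hc.tendsto.mono_left (nhdsWithin_le_nhds (s := {4}ᶜ))
    rw [rootPart_of_le h0 le_rfl, mul_zero] at ht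
    refine ht.congr' ?_
    filter_upwards [self_mem_nhdsWithin] with y hy
    have : y - 4 ≠ 0 := sub_ne_zero.2 hy
    rw [slope_def_field, optionPart_of_le h0.le le_rfl, optionPart]
    field_simp
    simp
  · have h1 := (((hasDerivAt_id x).mul ((hasDerivAt_id x).sub_const 4)).mul (hasDerivAt_rootPart h))
    refine h1.congr_deriv ?_
    have hr := rootPart_pos h
    have h2 := rootPart_sq h.le
    simp only [id, Pi.mul_apply, optionSlope]
    field_simp
    field_simp at h2
    linear_combination -2 * h2

theorem continuousOn_optionPart : ContinuousOn optionPart (Ioi 0) :=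
  fun _ hx => (hasDerivAt_optionPart hx).continuousAt.continuousWithinAt

theorem continuousAt_optionSlope {x : ℝ} (h0 : 0 < x) : ContinuousAt optionSlope x := by
  unfold optionSlope
  have := continuousAt_rootPart h0
  fun_prop

theorem hasDerivAt_optionSlope {x : ℝ} (h : 4 < x) : HasDerivAt optionSlope
    ((3 + 6 * rootPart x ^ 2 - rootPart x ^ 4) / (4 * rootPart x)) x := by
  have h1 := (((hasDerivAt_id x).sub_const 1).const_mul 2).mul (hasDerivAt_rootPart h)
  refine h1.congr_deriv ?_
  have hr := rootPart_pos h
  have hx : 0 < x := by linarith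
  have h2 := eq_of_rootPart h.le
  have h3 : 1 - rootPart x ^ 2 ≠ 0 := by nlinarith [rootPart_lt_one hx]
  set s := rootPart x
  simp only [id]
  rw [h2]
  field_simp
  ring

/-- In terms of `s`, the inequality `F'' > 2` for `F = optionPart` is `(1 - s)^3 (3 + s) > 0`. It
makes splitting an area into two parts longer than `4` more valuable the more unequal the parts are.
-/
theorem optionSlope_sub_two_mul_strictMonoOn :
    StrictMonoOn (fun x => optionSlope x - 2 * x) (Ici 4) := by
  refine strictMonoOn_of_deriv_pos (convex_Ici 4) (fun x hx => ?_) fun x hx => ?_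
  · have := continuousAt_optionSlope (lt_of_lt_of_le four_pos hx)
    exact ContinuousAt.continuousWithinAt (by fun_prop)
  · rw [interior_Ici] at hx
    have h : HasDerivAt (fun x => optionSlope x - 2 * x) _ x :=
      (hasDerivAt_optionSlope hx).sub ((hasDerivAt_id x).const_mul 2)
    rw [h.deriv]
    have hr := rootPart_pos hx
    have h1 := rootPart_lt_one (lt_trans four_pos hx)
    rw [mul_one, sub_pos, lt_div_iff₀ (by positivity)]
    set s := rootPart x
    have : 0 < (1 - s) ^ 3 * (3 + s) := by
      have : 0 < 1 - s := by linarith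
      positivity
    nlinarith

/-- The second derivative of `optionPart` blows up at `4`; it exceeds `4` as long as `s ≤ 1/5`, and
`25/6` is the length with `s = 1/5`. -/
theorem optionSlope_sub_four_mul_strictMonoOn :
    StrictMonoOn (fun x => optionSlope x - 4 * x) (Icc 4 (25 / 6)) := by
  refine strictMonoOn_of_deriv_pos (convex_Icc _ _) (fun x hx => ?_) fun x hx => ?_
  · have := continuousAt_optionSlope (lt_of_lt_of_le four_pos hx.1)
    exact ContinuousAt.continuousWithinAt (by fun_prop)
  · rw [interior_Icc] at hx
    have h : HasDerivAt (fun x => optionSlope x - 4 * x) _ x :=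
      (hasDerivAt_optionSlope hx.1).sub ((hasDerivAt_id x).const_mul 4)
    rw [h.deriv]
    have hr := rootPart_pos hx.1
    have h2 : rootPart x ≤ 1 / 5 := by
      have := rootPart_mono (lt_trans four_pos hx.1) hx.2.le
      refine this.trans (le_of_eq ?_)
      have := rootPart_eq (s := 1 / 5) (by norm_num)
      norm_num at this ⊢
      exact this
    rw [mul_one, sub_pos, lt_div_iff₀ (by positivity)]
    set s := rootPart x
    have h4 : s ^ 2 ≤ 1 / 25 := by nlinarith
    nlinarith [mul_le_mul_of_nonneg_left h4 (sq_nonneg s)]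

theorem optionSlope_nonneg {x : ℝ} (h0 : 0 < x) : 0 ≤ optionSlope x := by
  rcases le_total x 4 with h | h
  · rw [optionSlope_of_le h0 h]
  · have := rootPart_nonneg x
    have : 0 ≤ x - 1 := by linarith
    unfold optionSlope; positivity

theorem optionSlope_monotoneOn : MonotoneOn optionSlope (Ioi 0) := by
  intro x hx y hy hxy
  rcases le_total x 4 with h | h
  · rw [optionSlope_of_le hx h]; exact optionSlope_nonneg hy
  · have := optionSlope_sub_two_mul_strictMonoOn.monotoneOn h (h.trans hxy) hxy
    linarith

/-- Beyond `4` half the gap equals `(1 - s)^3 / (1 - s^2)`. The bound says that the value of an area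
falls in its length from `3` on. -/
theorem optionSlope_le {x : ℝ} (h : 3 ≤ x) : optionSlope x ≤ 2 * (x - 3) := by
  rcases le_total x 4 with h' | h'
  · rw [optionSlope_of_le (by linarith) h']; linarith
  · have h2 := eq_of_rootPart h'
    have h1 := rootPart_lt_one (x := x) (by linarith)
    have h0 := rootPart_nonneg x
    rw [optionSlope]
    set s := rootPart x
    have h3 : 0 < 1 - s ^ 2 := by nlinarith
    have : x - 3 - (x - 1) * s = (1 - s) ^ 3 / (1 - s ^ 2) := by
      rw [h2]; field_simp; ring
    have h4 : 0 ≤ (1 - s) ^ 3 / (1 - s ^ 2) := by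
      have : 0 ≤ 1 - s := by linarith
      positivity
    linarith

theorem optionPart_convexOn : ConvexOn ℝ (Ioi 0) optionPart := by
  refine MonotoneOn.convexOn_of_deriv (convex_Ioi 0) continuousOn_optionPart ?_ ?_
  · rw [interior_Ioi]; exact fun r hr => (hasDerivAt_optionPart hr).differentiableAt.differentiableWithinAt
  · rw [interior_Ioi]
    intro a ha b hb hab
    rw [(hasDerivAt_optionPart ha).deriv, (hasDerivAt_optionPart hb).deriv]
    exact optionSlope_monotoneOn ha hb hab

theorem optionPart_sub_sq_convexOn : ConvexOn ℝ (Ici 4) fun x => optionPart x - x ^ 2 := by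
  have hd : ∀ x : ℝ, 0 < x → HasDerivAt (fun x => optionPart x - x ^ 2) (optionSlope x - 2 * x) x := by
    intro x hx
    have := (hasDerivAt_optionPart hx).sub ((hasDerivAt_id x).pow 2)
    refine this.congr_deriv ?_
    simp
  refine MonotoneOn.convexOn_of_deriv (convex_Ici 4)
    (fun x hx => (hd x (four_pos.trans_le hx)).continuousAt.continuousWithinAt) ?_ ?_
  · rw [interior_Ici]
    exact fun x hx => (hd x (four_pos.trans hx)).differentiableAt.differentiableWithinAt
  · rw [interior_Ici]
    intro a ha b hb hab
    rw [(hd a (four_pos.trans ha)).deriv, (hd b (four_pos.trans hb)).deriv]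
    exact optionSlope_sub_two_mul_strictMonoOn.monotoneOn (mem_Ici.2 (le_of_lt ha))
      (mem_Ici.2 (le_of_lt hb)) hab

/-- A chord of `optionPart` is at least as steep as the tangent at its left end. -/
theorem optionSlope_mul_le {x y : ℝ} (h0 : 0 < x) (h : x ≤ y) :
    optionSlope x * (y - x) ≤ optionPart y - optionPart x := by
  rcases eq_or_lt_of_le h with rfl | h
  · simp
  · have := optionPart_convexOn.le_slope_of_hasDerivAt h0 (h0.trans h) h (hasDerivAt_optionPart h0)
    rw [slope_def_field, le_div_iff₀ (by linarith)] at this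
    exact this

theorem optionPart_monotoneOn : MonotoneOn optionPart (Ici 0) := by
  intro x hx y hy hxy
  rcases eq_or_lt_of_le (mem_Ici.1 hx) with rfl | h
  · rw [optionPart_of_le le_rfl (by norm_num)]; exact optionPart_nonneg hy
  · have := optionSlope_mul_le h hxy
    have := mul_nonneg (optionSlope_nonneg h) (sub_nonneg.2 hxy)
    linarith

/-! ### Questions at the midpoint of an area, with `q = 1` -/

theorem rootPart_strictMonoOn : StrictMonoOn rootPart (Ici 4) := by
  intro x hx y hy hxy
  have hx' := mem_Ici.1 hx
  refine lt_of_le_of_ne (rootPart_mono (by linarith) hxy.le) fun h => hxy.ne ?_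
  rw [eq_of_rootPart hx, eq_of_rootPart hy, h]

/-- The benefit-variance ratio of the midpoint of an area of length `X ≤ 8`. -/
noncomputable def midRatio (X : ℝ) : ℝ := X / 3 - 2 * optionPart X / (3 * X)

/-- The maximal payoff from the midpoint of an area of length `X ≤ 8`. -/
noncomputable def midPayoff (η X : ℝ) : ℝ := X / 4 * unitPayoff η (midRatio X)

theorem midRatio_of_le {X : ℝ} (h0 : 0 < X) (h : X ≤ 4) : midRatio X = X / 3 := by
  simp [midRatio, optionPart_of_le h0.le h]

theorem midRatio_eq {X : ℝ} (h : 4 ≤ X) : midRatio X = X * (1 - 2 * rootPart X ^ 3) / 3 := by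
  have : 0 < X := by linarith
  rw [midRatio, optionPart_eq h]
  field_simp

theorem rootPart_four_div {s X : ℝ} (h0 : 0 ≤ s) (h : X = 4 / (1 - s ^ 2)) : rootPart X = s := by
  rw [h, rootPart_eq h0]

theorem midRatio_pos {X : ℝ} (h0 : 0 < X) (h : X ≤ 8) : 0 < midRatio X := by
  rcases le_total X 4 with h' | h'
  · rw [midRatio_of_le h0 h']; positivity
  · rw [midRatio_eq h']
    have h1 := mul_one_sub_rootPart_sq h'
    have h2 := rootPart_nonneg X
    set s := rootPart X
    have h3 : s ^ 2 ≤ 1 / 2 := by nlinarith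
    have h4 : s ≤ 3 / 4 := by nlinarith
    have : 0 < 1 - 2 * s ^ 3 := by nlinarith
    positivity

/-- The slope depends on `X` only through `s = rootPart X` and decreases in `s` on `[0, 1]`.
Concavity follows, and the peak is where `s^3 - 3s + 1` vanishes. -/
theorem hasDerivAt_midRatio {X : ℝ} (h0 : 0 < X) :
    HasDerivAt midRatio ((1 - 3 * rootPart X + rootPart X ^ 3) / 3) X := by
  have h3 : (3 * X) ≠ 0 := by positivity
  have h1 : HasDerivAt midRatio _ X := ((hasDerivAt_id X).div_const 3).sub
    (((hasDerivAt_optionPart h0).const_mul 2).div ((hasDerivAt_id X).const_mul 3) h3)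
  refine h1.congr_deriv ?_
  rcases le_total X 4 with h | h
  · simp [rootPart_of_le h0 h, optionPart_of_le h0.le h, optionSlope_of_le h0 h]
  · have h2 := mul_one_sub_rootPart_sq h
    simp only [optionSlope, optionPart]
    field_simp
    linear_combination (rootPart X) * h2

theorem continuousOn_midRatio : ContinuousOn midRatio (Ioi 0) :=
  fun _ hX => (hasDerivAt_midRatio hX).continuousAt.continuousWithinAt

theorem midRatio_concaveOn : ConcaveOn ℝ (Ioi 0) midRatio := by
  refine AntitoneOn.concaveOn_of_deriv (convex_Ioi 0) continuousOn_midRatio ?_ ?_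
  · rw [interior_Ioi]
    exact fun r hr => (hasDerivAt_midRatio hr).differentiableAt.differentiableWithinAt
  · rw [interior_Ioi]
    intro a ha b hb hab
    rw [(hasDerivAt_midRatio ha).deriv, (hasDerivAt_midRatio hb).deriv]
    have h1 := rootPart_mono ha hab
    have h2 := rootPart_lt_one hb
    have h3 := rootPart_nonneg a
    have : (rootPart b - rootPart a) * (rootPart b ^ 2 + rootPart a * rootPart b + rootPart a ^ 2 - 3)
        ≤ 0 := mul_nonpos_of_nonneg_of_nonpos (by linarith) (by nlinarith)
    linarith

theorem continuousOn_midPayoff (hη : 0 < η) : ContinuousOn (midPayoff η) (Ioi 0) :=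
  (continuousOn_id.div_const 4).mul ((continuous_unitPayoff hη).comp_continuousOn continuousOn_midRatio)

theorem midPayoff_pos (hη : 0 < η) {X : ℝ} (h0 : 0 < X) (h : X ≤ 8) : 0 < midPayoff η X :=
  mul_pos (by positivity) (unitPayoff_pos hη (midRatio_pos h0 h))

/-- The log of the length is strictly concave, and `log ∘ unitPayoff` is concave and increasing, so
it stays concave after composition with the concave `midRatio`. Length `8` is the limit because each
half must be no longer than `4`. -/
theorem log_midPayoff_strictConcaveOn (hη : 0 < η) :
    StrictConcaveOn ℝ (Ioc 0 8) fun X => Real.log (midPayoff η X) := by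
  have h1 : StrictConcaveOn ℝ (Ioc 0 8) Real.log :=
    strictConcaveOn_log_Ioi.subset (fun x hx => hx.1) (convex_Ioc 0 8)
  have h2 : ConcaveOn ℝ (Ioc 0 8) fun X => Real.log (unitPayoff η (midRatio X)) := by
    refine ⟨convex_Ioc 0 8, fun x hx y hy a b ha hb hab => ?_⟩
    have hx' := midRatio_pos hx.1 hx.2
    have hy' := midRatio_pos hy.1 hy.2
    have hc := midRatio_concaveOn.2 (mem_Ioi.2 hx.1) (mem_Ioi.2 hy.1) ha hb hab
    have hp : 0 < a • midRatio x + b • midRatio y := (convex_Ioi (0 : ℝ)) hx' hy' ha hb hab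
    have hl := (log_unitPayoff_concaveOn hη).2 hx' hy' ha hb hab
    refine hl.trans (Real.log_le_log (unitPayoff_pos hη hp) ?_)
    exact (unitPayoff_strictMonoOn hη).monotoneOn hp.le (hp.le.trans hc) hc
  have h3 := (h1.add_concaveOn h2).add_const (Real.log (1 / 4))
  refine h3.congr fun X hX => ?_
  have hg := unitPayoff_pos hη (midRatio_pos hX.1 hX.2)
  have hX0 := hX.1
  simp only [Pi.add_apply, midPayoff]
  rw [Real.log_mul (by positivity) hg.ne', div_eq_mul_one_div X, Real.log_mul hX0.ne' (by norm_num)]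
  ring

/-- A point strictly between `x` and `m` has a value above the smaller of `f x` and `f m`; as `f m`
is maximal, the value exceeds `f x`. -/
theorem _root_.StrictConcaveOn.strictMonoOn_of_isMaxOn {s : Set ℝ} {f : ℝ → ℝ} {m : ℝ}
    (hf : StrictConcaveOn ℝ s f) (hm : m ∈ s) (hmax : IsMaxOn f s m) :
    StrictMonoOn f (s ∩ Iic m) := by
  intro x hx y hy hxy
  rcases eq_or_lt_of_le (mem_Iic.1 hy.2) with rfl | h
  · refine lt_of_le_of_ne (hmax hx.1) fun h => ?_
    have := hf.eq_of_isMaxOn (fun z hz => (hmax hz).trans h.ge) hmax hx.1 hm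
    exact hxy.ne this
  · have := hf.lt_on_openSegment hx.1 hm (hxy.trans h).ne
      (by rw [openSegment_eq_Ioo (hxy.trans h)]; exact ⟨hxy, h⟩ : y ∈ openSegment ℝ x m)
    rcases min_lt_iff.1 this with h1 | h1
    · exact h1
    · exact absurd (hmax hy.1) (not_le.2 h1)

theorem _root_.StrictConcaveOn.strictAntiOn_of_isMaxOn {s : Set ℝ} {f : ℝ → ℝ} {m : ℝ}
    (hf : StrictConcaveOn ℝ s f) (hm : m ∈ s) (hmax : IsMaxOn f s m) :
    StrictAntiOn f (s ∩ Ici m) := by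
  intro x hx y hy hxy
  rcases eq_or_lt_of_le (mem_Ici.1 hx.2) with rfl | h
  · refine lt_of_le_of_ne (hmax hy.1) fun h => ?_
    have := hf.eq_of_isMaxOn (fun z hz => (hmax hz).trans h.ge) hmax hy.1 hm
    exact hxy.ne this.symm
  · have := hf.lt_on_openSegment hm hy.1 (h.trans hxy).ne
      (by rw [openSegment_eq_Ioo (h.trans hxy)]; exact ⟨h, hxy⟩ : x ∈ openSegment ℝ m y)
    rcases min_lt_iff.1 this with h1 | h1
    · exact absurd (hmax hx.1) (not_le.2 h1)
    · exact h1

/-! ### Peaks of the ratio and of the payoff at the midpoint -/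

/-- The area length that maximizes the benefit-variance ratio. -/
noncomputable def ratioPeak : ℝ := 8 * Real.cos (Real.pi / 18) / √3

/-- The cubic is the triple-angle formula for the sine at `π/18`, since `sin(π/6) = 1/2`. -/
theorem two_mul_sin_pi_div_eighteen :
    0 < 2 * Real.sin (Real.pi / 18) ∧ 2 * Real.sin (Real.pi / 18) < 1 ∧
      (2 * Real.sin (Real.pi / 18)) ^ 3 - 3 * (2 * Real.sin (Real.pi / 18)) + 1 = 0 := by
  have hp := Real.pi_pos
  have h6 : Real.sin (Real.pi / 6) = 1 / 2 := Real.sin_pi_div_six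
  refine ⟨?_, ?_, ?_⟩
  · have := Real.sin_pos_of_pos_of_lt_pi (x := Real.pi / 18) (by positivity) (by linarith)
    positivity
  · have : Real.sin (Real.pi / 18) < Real.sin (Real.pi / 6) :=
      Real.sin_lt_sin_of_lt_of_le_pi_div_two (by linarith) (by linarith) (by linarith)
    linarith
  · have h := Real.sin_three_mul (Real.pi / 18)
    rw [show 3 * (Real.pi / 18) = Real.pi / 6 by ring, h6] at h
    linarith

/-- With `c = cos(π/18)` the denominator is `4c^2 - 3`, and the triple-angle formula gives `c (4c^2
- 3) = √3/2`. -/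
theorem ratioPeak_eq : ratioPeak = 4 / (1 - (2 * Real.sin (Real.pi / 18)) ^ 2) := by
  have hp := Real.pi_pos
  obtain ⟨h0, h1, -⟩ := two_mul_sin_pi_div_eighteen
  have h := Real.cos_three_mul (Real.pi / 18)
  rw [show 3 * (Real.pi / 18) = Real.pi / 6 by ring, Real.cos_pi_div_six] at h
  have hsc := Real.sin_sq_add_cos_sq (Real.pi / 18)
  have h3 : √3 ^ 2 = 3 := Real.sq_sqrt (by norm_num)
  have h30 : 0 < √3 := by positivity
  have hd : 1 - (2 * Real.sin (Real.pi / 18)) ^ 2 ≠ 0 := by nlinarith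
  rw [ratioPeak, div_eq_div_iff h30.ne' hd]
  linear_combination (-8 * Real.cos (Real.pi / 18) * 4) * hsc - 8 * h

theorem rootPart_ratioPeak : 347 / 1000 < rootPart ratioPeak ∧ rootPart ratioPeak < 348 / 1000 ∧
    rootPart ratioPeak ^ 3 - 3 * rootPart ratioPeak + 1 = 0 := by
  obtain ⟨h0, h1, h2⟩ := two_mul_sin_pi_div_eighteen
  rw [rootPart_four_div h0.le ratioPeak_eq]
  set s := 2 * Real.sin (Real.pi / 18)
  refine ⟨?_, ?_, h2⟩
  · by_contra h
    nlinarith [mul_nonneg h0.le (sub_nonneg.2 (not_lt.1 h))]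
  · by_contra h
    nlinarith [mul_nonneg h0.le (sub_nonneg.2 (not_lt.1 h)), mul_nonneg (sub_nonneg.2 h1.le) (sub_nonneg.2 (not_lt.1 h))]

theorem four_lt_ratioPeak : 4 < ratioPeak := by
  by_contra h
  have h0 : 0 < ratioPeak := by
    have := Real.cos_pos_of_mem_Ioo (x := Real.pi / 18)
      ⟨by linarith [Real.pi_pos], by linarith [Real.pi_pos]⟩
    unfold ratioPeak; positivity
  have := rootPart_of_le h0 (not_lt.1 h)
  have := rootPart_ratioPeak.1
  linarith

theorem ratioPeak_bounds : 4547 / 1000 < ratioPeak ∧ ratioPeak < 4552 / 1000 := by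
  have h := mul_one_sub_rootPart_sq four_lt_ratioPeak.le
  obtain ⟨h1, h2, -⟩ := rootPart_ratioPeak
  have h4 := four_lt_ratioPeak
  set s := rootPart ratioPeak
  have h5 : s ^ 2 < 122 / 1000 - 89 / 100000 := by nlinarith
  have h6 : 1204 / 10000 < s ^ 2 := by nlinarith
  constructor <;> nlinarith

theorem midRatio_ratioPeak : midRatio ratioPeak = ratioPeak * (1 - 2 * rootPart ratioPeak) := by
  rw [midRatio_eq four_lt_ratioPeak.le]
  linear_combination (-2 / 3 * ratioPeak) * rootPart_ratioPeak.2.2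

theorem midRatio_ratioPeak_bounds :
    138 / 100 < midRatio ratioPeak ∧ midRatio ratioPeak < 1393 / 1000 := by
  obtain ⟨h1, h2, -⟩ := rootPart_ratioPeak
  obtain ⟨h3, h4⟩ := ratioPeak_bounds
  rw [midRatio_ratioPeak]
  constructor <;> nlinarith

theorem midRatio_strictMonoOn : StrictMonoOn midRatio (Ioc 0 ratioPeak) := by
  refine strictMonoOn_of_deriv_pos (convex_Ioc _ _)
    (continuousOn_midRatio.mono fun x hx => hx.1) fun x hx => ?_
  rw [interior_Ioc] at hx
  rw [(hasDerivAt_midRatio hx.1).deriv]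
  obtain ⟨h1, h2, h3⟩ := rootPart_ratioPeak
  have h4 : rootPart x < rootPart ratioPeak := by
    rcases le_total x 4 with h | h
    · rw [rootPart_of_le hx.1 h]; linarith
    · exact rootPart_strictMonoOn h four_lt_ratioPeak.le hx.2
  have h0 := rootPart_nonneg x
  -- The cubic vanishes at the peak, so its value at `s` is the difference from the peak root times
  -- this positive factor.
  nlinarith [mul_pos (sub_pos.2 h4) (show 0 < 3 - (rootPart x ^ 2 + rootPart x * rootPart ratioPeak +
    rootPart ratioPeak ^ 2) by nlinarith)]

theorem midRatio_strictAntiOn : StrictAntiOn midRatio (Ici ratioPeak) := by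
  have hp := four_lt_ratioPeak
  refine strictAntiOn_of_deriv_neg (convex_Ici _)
    (continuousOn_midRatio.mono fun x hx => lt_of_lt_of_le (four_pos.trans hp) hx) fun x hx => ?_
  rw [interior_Ici] at hx
  have hx' := mem_Ioi.1 hx
  rw [(hasDerivAt_midRatio (by linarith)).deriv]
  obtain ⟨h1, h2, h3⟩ := rootPart_ratioPeak
  have h4 : rootPart ratioPeak < rootPart x :=
    rootPart_strictMonoOn hp.le (hp.le.trans hx'.le) hx'
  have h5 := rootPart_lt_one (x := x) (by linarith)
  nlinarith [mul_pos (sub_pos.2 h4) (show 0 < 3 - (rootPart x ^ 2 + rootPart x * rootPart ratioPeak +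
    rootPart ratioPeak ^ 2) by nlinarith)]

theorem midRatio_lt_of_ne {X : ℝ} (h0 : 0 < X) (h : X ≠ ratioPeak) :
    midRatio X < midRatio ratioPeak := by
  have hp := four_lt_ratioPeak
  rcases lt_or_gt_of_ne h with h | h
  · exact midRatio_strictMonoOn ⟨h0, h.le⟩ ⟨by linarith, le_rfl⟩ h
  · exact midRatio_strictAntiOn self_mem_Ici h.le h

theorem midPayoff_eq_questionPayoff {X : ℝ} (h0 : 0 < X) :
    midPayoff η X = questionPayoff η (X / 4 * midRatio X) (X / 4) := by
  rw [midPayoff, questionPayoff]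
  congr 2
  field_simp

/-- At `ratioPeak` the ratio is stationary while the variance still grows, so a longer area pays
more. The witness `100/21` is slightly longer and has `s = 2/5`. -/
theorem midPayoff_ratioPeak_lt (hη : 0 < η) :
    midPayoff η ratioPeak < midPayoff η (100 / 21) := by
  obtain ⟨h3, h4⟩ := ratioPeak_bounds
  obtain ⟨h5, h6⟩ := midRatio_ratioPeak_bounds
  have hs : rootPart (100 / 21) = 2 / 5 := rootPart_four_div (by norm_num) (by norm_num)
  have hm : midRatio (100 / 21) = 436 / 315 := by
    rw [midRatio_eq (by norm_num), hs]; norm_num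
  rw [midPayoff_eq_questionPayoff (by linarith), midPayoff_eq_questionPayoff (by norm_num), hm]
  refine questionPayoff_lt hη (by norm_num) (by linarith) (by nlinarith) fun κ hκ hκ' => ?_
  have : ratioPeak / 4 * midRatio ratioPeak / (2 * (ratioPeak / 4)) = midRatio ratioPeak / 2 := by
    field_simp
  rw [this] at hκ'
  nlinarith

/-- From `25/4` on, where `s ≥ 3/5`, the benefit `(x^2 - 2 F x) / 12` of the midpoint no longer
rises, while its variance does. -/
theorem midPayoff_lt_of_gt (hη : 0 < η) {X : ℝ} (h : 25 / 4 < X) (h8 : X ≤ 8) :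
    midPayoff η X < midPayoff η (25 / 4) := by
  have hd : ∀ x : ℝ, 0 < x → HasDerivAt (fun x => x ^ 2 - 2 * optionPart x)
      (2 * x - 2 * optionSlope x) x := fun x hx => by
    refine (((hasDerivAt_id x).pow 2).sub ((hasDerivAt_optionPart hx).const_mul 2)).congr_deriv ?_
    simp
  have hanti : AntitoneOn (fun x => x ^ 2 - 2 * optionPart x) (Ici (25 / 4)) := by
    refine antitoneOn_of_deriv_nonpos (convex_Ici _) (fun x hx => ?_) (fun x hx => ?_) fun x hx => ?_
    · exact (hd x (lt_of_lt_of_le (by norm_num) hx)).continuousAt.continuousWithinAt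
    · rw [interior_Ici] at hx
      exact (hd x (lt_trans (by norm_num) hx)).differentiableAt.differentiableWithinAt
    · rw [interior_Ici] at hx
      have hx' := mem_Ioi.1 hx
      rw [(hd x (by linarith)).deriv, optionSlope]
      have : 3 / 5 ≤ rootPart x := by
        rw [← rootPart_four_div (s := 3 / 5) (X := 25 / 4) (by norm_num) (by norm_num)]
        exact rootPart_mono (by norm_num) hx'.le
      nlinarith
  have key := hanti self_mem_Ici h.le h.le
  simp only at key
  have he : ∀ x : ℝ, 0 < x → x / 4 * midRatio x = (x ^ 2 - 2 * optionPart x) / 12 := by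
    intro x hx; rw [midRatio]; field_simp; ring
  have hX : 0 < X := by linarith
  have hpos := midRatio_pos hX h8
  rw [midPayoff_eq_questionPayoff hX, midPayoff_eq_questionPayoff (by norm_num)]
  refine questionPayoff_lt_of_lt hη (by norm_num) (by positivity) ?_ (by linarith)
  rw [he X hX, he _ (by norm_num)]
  linarith

/-- The payoff from the midpoint is single peaked in the length of the area. -/
theorem exists_midPayoff_peak (hη : 0 < η) : ∃ m, ratioPeak < m ∧ m ≤ 25 / 4 ∧
    StrictMonoOn (midPayoff η) (Ioc 0 m) ∧ StrictAntiOn (midPayoff η) (Icc m 8) := by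
  obtain ⟨h3, h4⟩ := ratioPeak_bounds
  obtain ⟨m, hm, hmax⟩ := isCompact_Icc.exists_isMaxOn (nonempty_Icc.2 (show (4 : ℝ) ≤ 8 by norm_num))
    ((continuousOn_midPayoff hη).mono fun x hx => lt_of_lt_of_le four_pos hx.1)
  have hm25 : m ≤ 25 / 4 := by
    by_contra h
    have := hmax (show (25 / 4 : ℝ) ∈ Icc 4 8 by norm_num)
    exact absurd (midPayoff_lt_of_gt hη (not_le.1 h) hm.2) (not_lt.2 this)
  have hmono : StrictMonoOn (midPayoff η) (Ioc 0 ratioPeak) := by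
    intro x hx y hy hxy
    have h1 := midRatio_strictMonoOn hx hy hxy
    have h2 := midRatio_pos hx.1 (by linarith [hx.2])
    have h3 := unitPayoff_strictMonoOn hη h2.le (h2.trans h1).le h1
    exact mul_lt_mul'' (by linarith) h3 (by linarith [hx.1]) (unitPayoff_nonneg hη _)
  have hpk : ratioPeak < m := by
    by_contra h
    have h5 := hmono.monotoneOn ⟨by linarith [hm.1], not_lt.1 h⟩ ⟨by linarith, le_rfl⟩ (not_lt.1 h)
    have h6 := hmax (show (100 / 21 : ℝ) ∈ Icc 4 8 by norm_num)
    exact absurd (midPayoff_ratioPeak_lt hη) (not_lt.2 (h6.trans h5))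
  -- The maximum was taken over the compact `[4, 8]`; below `4` length and ratio both increase, so
  -- it is a maximum on `(0, 8]`, where log-concavity applies.
  have hmax8 : IsMaxOn (fun X => Real.log (midPayoff η X)) (Ioc 0 8) m := by
    intro x hx
    refine Real.log_le_log (midPayoff_pos hη hx.1 hx.2) ?_
    rcases le_total x 4 with h | h
    · exact (hmono.monotoneOn ⟨hx.1, by linarith⟩ ⟨by norm_num, by linarith⟩ h).trans
        (hmax (show (4 : ℝ) ∈ Icc 4 8 by norm_num))
    · exact hmax ⟨h, hx.2⟩
  have hm8 : m ∈ Ioc (0 : ℝ) 8 := ⟨by linarith [hm.1], hm.2⟩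
  refine ⟨m, hpk, hm25, fun x hx y hy hxy => ?_, fun x hx y hy hxy => ?_⟩
  · have hx8 : x ≤ 8 := hx.2.trans hm.2
    have hy8 : y ≤ 8 := hy.2.trans hm.2
    exact (Real.log_lt_log_iff (midPayoff_pos hη hx.1 hx8) (midPayoff_pos hη hy.1 hy8)).1
      ((log_midPayoff_strictConcaveOn hη).strictMonoOn_of_isMaxOn hm8 hmax8
        ⟨⟨hx.1, hx8⟩, hx.2⟩ ⟨⟨hy.1, hy8⟩, hy.2⟩ hxy)
  · have hx0 : 0 < x := hm8.1.trans_le hx.1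
    have hy0 : 0 < y := hm8.1.trans_le hy.1
    exact (Real.log_lt_log_iff (midPayoff_pos hη hy0 hy.2) (midPayoff_pos hη hx0 hx.2)).1
      ((log_midPayoff_strictConcaveOn hη).strictAntiOn_of_isMaxOn hm8 hmax8
        ⟨⟨hx0, hx.2⟩, hx.1⟩ ⟨⟨hy0, hy.2⟩, hy.1⟩ hxy)

/-! ### The optimal distance in an area, with `q = 1` -/

/-- The value of an area of length `x`. -/
noncomputable def areaValue (x : ℝ) : ℝ := x - x ^ 2 / 6 + optionPart x / 6

/-- The benefit of a question at distance `d` from an endpoint of an area of length `X`. -/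
noncomputable def areaBenefit (X d : ℝ) : ℝ := areaValue d + areaValue (X - d) - areaValue X

/-- The variance of a question at distance `d` from an endpoint of an area of length `X`. -/
noncomputable def areaVar (X d : ℝ) : ℝ := d * (X - d) / X

/-- The maximal payoff from distance `d` in an area of length `X`. -/
noncomputable def distancePayoff (η X d : ℝ) : ℝ :=
  questionPayoff η (areaBenefit X d) (areaVar X d)

/-- The distance `d` maximizes the payoff in an area of length `X`. -/
def IsBestDistance (η X d : ℝ) : Prop :=
  d ∈ Icc 0 (X / 2) ∧ IsMaxOn (distancePayoff η X) (Icc 0 (X / 2)) d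

theorem areaBenefit_eq (X d : ℝ) : areaBenefit X d =
    (2 * d * (X - d) + optionPart d + optionPart (X - d) - optionPart X) / 6 := by
  unfold areaBenefit areaValue; ring

theorem areaVar_pos {X d : ℝ} (h0 : 0 < d) (h : d < X) : 0 < areaVar X d := by
  have : 0 < X := by linarith
  have : 0 < X - d := by linarith
  unfold areaVar; positivity

theorem areaVar_nonneg {X d : ℝ} (h0 : 0 ≤ d) (h : d ≤ X) : 0 ≤ areaVar X d := by
  have : 0 ≤ X := by linarith
  have : 0 ≤ X - d := by linarith
  unfold areaVar; positivity

theorem distancePayoff_symm (η X d : ℝ) : distancePayoff η X (X - d) = distancePayoff η X d := by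
  have h1 : areaBenefit X (X - d) = areaBenefit X d := by
    rw [areaBenefit, areaBenefit, sub_sub_cancel]; ring
  have h2 : areaVar X (X - d) = areaVar X d := by
    rw [areaVar, areaVar, sub_sub_cancel]; ring
  rw [distancePayoff, h1, h2, distancePayoff]

theorem distancePayoff_nonneg (hη : 0 < η) {X d : ℝ} (h0 : 0 ≤ d) (h : d ≤ X) :
    0 ≤ distancePayoff η X d := questionPayoff_nonneg hη (areaVar_nonneg h0 h)

@[simp] theorem distancePayoff_zero (η X : ℝ) : distancePayoff η X 0 = 0 := by
  simp [distancePayoff, questionPayoff, areaVar]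

theorem areaVar_half {X : ℝ} (h0 : 0 < X) : areaVar X (X / 2) = X / 4 := by
  unfold areaVar; field_simp; ring

theorem areaBenefit_half {X : ℝ} (h0 : 0 < X) (h : X ≤ 8) :
    areaBenefit X (X / 2) = X / 4 * midRatio X := by
  rw [areaBenefit_eq, sub_half, optionPart_of_le (by linarith) (by linarith), midRatio]
  field_simp; ring

theorem distancePayoff_half {X : ℝ} (h0 : 0 < X) (h : X ≤ 8) :
    distancePayoff η X (X / 2) = midPayoff η X := by
  rw [distancePayoff, areaVar_half h0, areaBenefit_half h0 h, midPayoff_eq_questionPayoff h0]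

theorem continuousOn_areaValue : ContinuousOn areaValue (Ici 0) := by
  have : ContinuousOn optionPart (Ici 0) := by
    intro x hx
    rcases eq_or_lt_of_le (mem_Ici.1 hx) with rfl | h
    · refine (continuousWithinAt_const (b := (0 : ℝ))).congr_of_eventuallyEq ?_
        (optionPart_of_le le_rfl (by norm_num))
      filter_upwards [self_mem_nhdsWithin, mem_nhdsWithin_of_mem_nhds (Iio_mem_nhds four_pos)]
        with y hy hy'
      exact optionPart_of_le hy (le_of_lt hy')
    · exact (continuousOn_optionPart.continuousAt (Ioi_mem_nhds h)).continuousWithinAt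
  unfold areaValue
  fun_prop

theorem continuousAt_areaValue {x : ℝ} (h : 0 < x) : ContinuousAt areaValue x :=
  continuousOn_areaValue.continuousAt (Ici_mem_nhds h)

theorem areaValue_zero : areaValue 0 = 0 := by
  simp [areaValue, optionPart]

theorem areaValue_of_le {x : ℝ} (h0 : 0 ≤ x) (h : x ≤ 4) : areaValue x = x - x ^ 2 / 6 := by
  simp [areaValue, optionPart_of_le h0 h]

theorem areaValue_antitoneOn : AntitoneOn areaValue (Ici 3) := by
  have hd : ∀ x : ℝ, 0 < x → HasDerivAt areaValue (1 - 2 * x / 6 + optionSlope x / 6) x := by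
    intro x hx
    have h : HasDerivAt areaValue _ x := ((hasDerivAt_id x).sub
      (((hasDerivAt_id x).pow 2).div_const 6)).add ((hasDerivAt_optionPart hx).div_const 6)
    refine h.congr_deriv ?_
    simp
  refine antitoneOn_of_deriv_nonpos (convex_Ici _) (fun x hx => ?_) (fun x hx => ?_) fun x hx => ?_
  · exact (hd x (three_pos.trans_le hx)).continuousAt.continuousWithinAt
  · rw [interior_Ici] at hx
    exact (hd x (three_pos.trans hx)).differentiableAt.differentiableWithinAt
  · rw [interior_Ici] at hx
    rw [(hd x (three_pos.trans hx)).deriv]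
    linarith [optionSlope_le (le_of_lt hx)]

theorem continuousAt_questionPayoff (hη : 0 < η) {α : Type*} [TopologicalSpace α] {V v : α → ℝ}
    {a : α} {s : Set α} (hV : ContinuousWithinAt V s a) (hv : ContinuousWithinAt v s a)
    (h : v a ≠ 0) : ContinuousWithinAt (fun x => questionPayoff η (V x) (v x)) s a := by
  unfold questionPayoff
  exact hv.mul ((continuous_unitPayoff hη).continuousAt.comp_continuousWithinAt (hV.div hv h))

theorem continuousOn_distancePayoff (hη : 0 < η) {X : ℝ} (h0 : 0 < X) :
    ContinuousOn (distancePayoff η X) (Icc 0 (X / 2)) := by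
  have hV : ContinuousOn (areaBenefit X) (Icc 0 (X / 2)) := by
    unfold areaBenefit
    refine ((continuousOn_areaValue.mono fun x hx => hx.1).add
      (continuousOn_areaValue.comp (by fun_prop) fun x hx => ?_)).sub continuousOn_const
    have := hx.2
    exact mem_Ici.2 (by linarith)
  intro d hd
  rcases eq_or_lt_of_le hd.1 with rfl | h
  -- At `d = 0` the ratio has a zero denominator, so continuity comes from squeezing the payoff
  -- between `0` and the absolute benefit.
  · have hb : Filter.Tendsto (fun d => |areaBenefit X d|) (nhdsWithin 0 (Icc 0 (X / 2))) (nhds 0) := by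
      have := (hV 0 hd).tendsto.abs
      simpa [areaBenefit, areaValue_zero] using this
    unfold ContinuousWithinAt
    rw [distancePayoff_zero]
    refine tendsto_of_tendsto_of_tendsto_of_le_of_le' tendsto_const_nhds hb ?_ ?_
    · filter_upwards [self_mem_nhdsWithin] with d hd
      exact distancePayoff_nonneg hη hd.1 (by linarith [hd.2])
    · filter_upwards [self_mem_nhdsWithin] with d hd
      have hv := areaVar_nonneg hd.1 (show d ≤ X by linarith [hd.2])
      rcases eq_or_lt_of_le (questionPayoff_nonneg hη hv (V := areaBenefit X d)) with h1 | h1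
      · rw [distancePayoff, ← h1]; exact abs_nonneg _
      · have h2 := (benefit_pos_of_questionPayoff_pos hη hv h1).1
        exact (questionPayoff_le hη h2.le hv).trans (le_abs_self _)
  · refine continuousAt_questionPayoff hη (hV d hd) ?_
      (areaVar_pos h (by linarith [hd.2])).ne'
    exact ContinuousAt.continuousWithinAt (by unfold areaVar; fun_prop)

theorem exists_isBestDistance (hη : 0 < η) {X : ℝ} (h0 : 0 < X) : ∃ d, IsBestDistance η X d :=
  isCompact_Icc.exists_isMaxOn (nonempty_Icc.2 (by positivity)) (continuousOn_distancePayoff hη h0)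

/-- In long areas a question at distance at most `3` is worth more than the same distance beyond
the frontier. -/
theorem areaValue_le_areaBenefit {X d : ℝ} (hX : 6 ≤ X) (h0 : 0 ≤ d) (hd : d ≤ 3) :
    areaValue d ≤ areaBenefit X d := by
  have := areaValue_antitoneOn (show 3 ≤ X - d by linarith) (show 3 ≤ X by linarith) (by linarith)
  rw [areaBenefit]; linarith

theorem IsBestDistance.payoff_pos (hη : 0 < η) {X d : ℝ} (h0 : 0 < X) (h : IsBestDistance η X d) :
    0 < distancePayoff η X d := by
  rcases le_total X 8 with hX | hX
  · refine lt_of_lt_of_le ?_ (h.2 (show X / 2 ∈ Icc 0 (X / 2) from ⟨by positivity, le_rfl⟩))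
    rw [distancePayoff_half h0 hX]
    exact midPayoff_pos hη h0 hX
  · refine lt_of_lt_of_le ?_ (h.2 (show (1 : ℝ) ∈ Icc 0 (X / 2) from ⟨by norm_num, by linarith⟩))
    refine questionPayoff_pos hη ?_ (areaVar_pos one_pos (by linarith))
    have := areaValue_le_areaBenefit (X := X) (d := 1) (by linarith) (by norm_num) (by norm_num)
    rw [areaValue_of_le (by norm_num) (by norm_num)] at this
    linarith

theorem IsBestDistance.spec (hη : 0 < η) {X d : ℝ} (h0 : 0 < X) (h : IsBestDistance η X d) :
    0 < d ∧ 0 < areaBenefit X d ∧ 0 < areaVar X d := by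
  have hp := h.payoff_pos hη h0
  obtain ⟨h1, h2⟩ := benefit_pos_of_questionPayoff_pos hη
    (areaVar_nonneg h.1.1 (by linarith [h.1.2])) hp
  refine ⟨lt_of_le_of_ne h.1.1 ?_, h1, h2⟩
  rintro rfl
  simp at hp

/-! ### Location of the optimal distance -/

/-- Six times benefit minus `3 (1 - a) X` times variance, up to a constant. -/
noncomputable def netBenefit (a X d : ℝ) : ℝ :=
  2 * a * (d * (X - d)) + optionPart d + optionPart (X - d)

/-- The variance is proportional to the quadratic part of the benefit, so charging a price `κ` only
rescales that part, by `a = 1 - 3κ/X`. -/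
theorem areaBenefit_sub {X : ℝ} (h0 : 0 < X) (κ d : ℝ) : areaBenefit X d - κ * areaVar X d =
    (netBenefit (1 - 3 * κ / X) X d - optionPart X) / 6 := by
  rw [areaBenefit_eq, areaVar, netBenefit]; field_simp; ring

theorem hasDerivAt_netBenefit (a : ℝ) {X d : ℝ} (h0 : 0 < d) (h : d < X) :
    HasDerivAt (netBenefit a X) (2 * a * (X - 2 * d) + optionSlope d - optionSlope (X - d)) d := by
  have h1 : HasDerivAt (fun d => X - d) (-1) d := by
    simpa using (hasDerivAt_id d).const_sub X
  have h2 : HasDerivAt (fun d => optionPart (X - d)) (optionSlope (X - d) * -1) d :=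
    (hasDerivAt_optionPart (by linarith)).comp d h1
  have h3 : HasDerivAt (netBenefit a X) _ d :=
    ((((hasDerivAt_id d).mul h1).const_mul (2 * a)).add (hasDerivAt_optionPart h0)).add h2
  refine h3.congr_deriv ?_
  simp only [id]; ring

/-- At its own price a best distance also maximizes benefit net of priced variance. A positive price
gives `a < 1`. For `d ≤ 4` the benefit is at most `d (X - d) / 3`, so the price is below `X / 6` and
`a > 1/2`. -/
theorem IsBestDistance.netBenefit_le (hη : 0 < η) {X d : ℝ} (h0 : 0 < X)
    (h : IsBestDistance η X d) : ∃ a, a < 1 ∧ (d ≤ 4 → 1 / 2 < a) ∧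
      ∀ δ ∈ Ioc 0 (X / 2), netBenefit a X δ ≤ netBenefit a X d := by
  obtain ⟨hd, hV, hv⟩ := h.spec hη h0
  obtain ⟨ρ, κ, hρ, hκ, hκ', he, hle⟩ := exists_price hη hV hv
  refine ⟨1 - 3 * κ / X, ?_, fun hd4 => ?_, fun δ hδ => ?_⟩
  · have : 0 < 3 * κ / X := by positivity
    linarith
  · have hdX : d ≤ X / 2 := h.1.2
    have hF := optionPart_monotoneOn (show 0 ≤ X - d by linarith) (show 0 ≤ X by linarith)
      (show X - d ≤ X by linarith)
    have hx : 0 < X - d := by linarith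
    rw [lt_div_iff₀ (by positivity), areaBenefit_eq, optionPart_of_le hd.le hd4, areaVar] at hκ'
    have h3 : 3 * κ / X < 1 / 2 := by
      rw [div_lt_iff₀ h0]
      have h4 : κ * (2 * (d * (X - d) / X)) = 6 * κ / X * (d * (X - d)) / 3 := by field_simp; ring
      rw [h4] at hκ'
      have h5 : 6 * κ / X * (d * (X - d)) < d * (X - d) := by linarith
      have h6 : 6 * κ / X < 1 := by
        by_contra hc
        nlinarith [mul_pos hd hx]
      rw [div_lt_one h0] at h6
      linarith
    linarith
  · have h1 := (hle (areaBenefit X δ) (areaVar X δ) (areaVar_pos hδ.1 (by linarith [hδ.2]))).trans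
      (h.2 (show δ ∈ Icc 0 (X / 2) from ⟨hδ.1.le, hδ.2⟩))
    rw [distancePayoff, he] at h1
    have h2 := le_of_mul_le_mul_left h1 hρ
    rw [areaBenefit_sub h0, areaBenefit_sub h0] at h2
    linarith

/-- An interior maximum is stationary. If `d ≥ 4`, `F'' > 2 > 2a` makes the derivative negative. If
`d < 4`, stationarity forces `X - d` into `(4, 25/6]`, where `F'' > 4 > 4a` makes the point a local
minimum from the right. -/
theorem exists_netBenefit_gt {a X d : ℝ} (ha : a < 1) (ha' : d ≤ 4 → 1 / 2 < a)
    (hd : 18 / 5 ≤ d) (hdX : d < X / 2) :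
    ∃ δ ∈ Ioc 0 (X / 2), netBenefit a X d < netBenefit a X δ := by
  by_contra! hmax
  have hder := hasDerivAt_netBenefit a (show 0 < d by linarith) (show d < X by linarith)
  have hloc : IsLocalMax (netBenefit a X) d := by
    filter_upwards [Ioo_mem_nhds (show 0 < d by linarith) hdX] with δ hδ
    exact hmax δ ⟨hδ.1, hδ.2.le⟩
  have h0 := hloc.hasDerivAt_eq_zero hder
  rcases le_or_gt 4 d with h4 | h4
  · have := optionSlope_sub_two_mul_strictMonoOn h4 (show 4 ≤ X - d by linarith)
      (show d < X - d by linarith)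
    simp only at this
    nlinarith
  · have ha2 := ha' h4.le
    rw [optionSlope_of_le (by linarith) h4.le] at h0
    rcases le_or_gt (X - d) 4 with h5 | h5
    · rw [optionSlope_of_le (by linarith) h5] at h0
      nlinarith
    -- Stationarity and `a < 1` give `d (1 - s^2) < 4 - 3s - s^3`, which fails for `d ≥ 18/5` once
    -- `s ≥ 1/5`.
    · have hs : rootPart (X - d) < 1 / 5 := by
        have h6 : optionSlope (X - d) < 2 * (X - 2 * d) := by nlinarith
        have h7 := mul_one_sub_rootPart_sq h5.le
        have h8 := rootPart_lt_one (show 0 < X - d by linarith)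
        have h9 := rootPart_nonneg (X - d)
        rw [optionSlope] at h6
        set s := rootPart (X - d)
        have h10 : d < (X - d) - (X - d - 1) * s := by linarith
        have h11 : 0 < 1 - s ^ 2 := by nlinarith
        have h12 : d * (1 - s ^ 2) < 4 - (3 + s ^ 2) * s := by
          calc d * (1 - s ^ 2) < ((X - d) - (X - d - 1) * s) * (1 - s ^ 2) := by gcongr
            _ = (X - d) * (1 - s ^ 2) - ((X - d) * (1 - s ^ 2) - (1 - s ^ 2)) * s := by ring
            _ = _ := by rw [h7]; ring
        by_contra hc
        rw [not_lt] at hc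
        nlinarith [mul_nonneg (sub_nonneg.2 hd) h11.le, mul_nonneg (sub_nonneg.2 hc) (sub_nonneg.2 h8.le)]
      have hx : X - d ≤ 25 / 6 := by
        by_contra hc
        have := rootPart_mono (show (0 : ℝ) < 25 / 6 by norm_num) (not_le.1 hc).le
        rw [rootPart_four_div (s := 1 / 5) (by norm_num) (by norm_num)] at this
        linarith
      -- Moving right up to `min e 4` keeps the point in the left half, its short part at most `4`
      -- and its long part at least `4`.
      set e := min (X / 2) (X - 4) with he
      have hde : d < e := lt_min hdX (by linarith)
      have hmono : StrictMonoOn (netBenefit a X) (Icc d (min e 4)) := by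
        refine strictMonoOn_of_deriv_pos (convex_Icc _ _) (fun δ hδ => ?_) fun δ hδ => ?_
        · have h1 := hδ.2.trans (min_le_left _ _)
          have h2 := h1.trans (min_le_left _ _)
          exact (hasDerivAt_netBenefit a (by linarith [hδ.1]) (by linarith)).continuousAt.continuousWithinAt
        · rw [interior_Icc] at hδ
          have h1 := hδ.2.trans_le (min_le_left _ _)
          have h2 := h1.trans_le (min_le_left _ _)
          have h3 := h1.trans_le (min_le_right _ _)
          have h4 := hδ.2.trans_le (min_le_right _ _)
          rw [(hasDerivAt_netBenefit a (by linarith [hδ.1]) (by linarith)).deriv,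
            optionSlope_of_le (by linarith [hδ.1]) h4.le]
          have h6 := optionSlope_sub_four_mul_strictMonoOn (a := X - δ) (b := X - d)
            ⟨by linarith, by linarith [hδ.1]⟩ ⟨h5.le, hx⟩ (by linarith [hδ.1])
          simp only at h6
          nlinarith [hδ.1]
      have hlt : d < min e 4 := lt_min hde h4
      have h1 := hmono (left_mem_Icc.2 hlt.le) (right_mem_Icc.2 hlt.le) hlt
      have h2 := hmax (min e 4) ⟨by linarith, (min_le_left _ _).trans (min_le_left _ _)⟩
      linarith

theorem exists_netBenefit_half_lt {a X : ℝ} (ha : a < 1) (hX : 8 ≤ X) :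
    ∃ δ ∈ Ioc 0 (X / 2), netBenefit a X (X / 2) < netBenefit a X δ := by
  obtain ⟨c, hc0, hc, hneg⟩ : ∃ c, 0 < c ∧ c < X / 2 ∧ ∀ δ ∈ Ioo c (X / 2),
      2 * a * (X - 2 * δ) + optionSlope δ - optionSlope (X - δ) < 0 := by
    rcases eq_or_lt_of_le hX with rfl | h
    -- At length `8` the left part is below `4`, so the bound `F'' > 4` is used; `23/6 = 8 - 25/6`
    -- keeps the right part in its range.
    · refine ⟨23 / 6, by norm_num, by norm_num, fun δ hδ => ?_⟩
      have h1 := hδ.1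
      have h2 := hδ.2
      rw [optionSlope_of_le (by linarith) (by linarith)]
      have h6 := optionSlope_sub_four_mul_strictMonoOn (a := 4) (b := 8 - δ)
        ⟨by linarith, by norm_num⟩ ⟨by linarith, by linarith⟩ (by linarith)
      simp only at h6
      rw [optionSlope_of_le (by linarith) (by linarith)] at h6
      nlinarith
    · refine ⟨4, by norm_num, by linarith, fun δ hδ => ?_⟩
      have h1 := hδ.1
      have h2 := hδ.2
      have h6 := optionSlope_sub_two_mul_strictMonoOn (a := δ) (b := X - δ) h1.le
        (show 4 ≤ X - δ by linarith) (by linarith)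
      simp only at h6
      nlinarith
  have hanti : StrictAntiOn (netBenefit a X) (Icc c (X / 2)) := by
    refine strictAntiOn_of_deriv_neg (convex_Icc _ _) (fun δ hδ => ?_) fun δ hδ => ?_
    · exact (hasDerivAt_netBenefit a (by linarith [hδ.1]) (by linarith [hδ.2])).continuousAt.continuousWithinAt
    · rw [interior_Icc] at hδ
      rw [(hasDerivAt_netBenefit a (by linarith [hδ.1]) (by linarith [hδ.2])).deriv]
      exact hneg δ hδ
  exact ⟨c, ⟨hc0, hc.le⟩, hanti (left_mem_Icc.2 hc.le) (right_mem_Icc.2 hc.le) hc⟩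

/-- The optimal distance is below `18 / 5` or it is the midpoint of an area shorter than `8`. -/
theorem IsBestDistance.lt_or_eq (hη : 0 < η) {X d : ℝ} (h0 : 0 < X) (h : IsBestDistance η X d) :
    d < 18 / 5 ∨ d = X / 2 ∧ X < 8 := by
  obtain ⟨a, ha, ha', hmax⟩ := h.netBenefit_le hη h0
  by_contra! hc
  rcases eq_or_lt_of_le h.1.2 with h1 | h1
  · obtain ⟨δ, hδ, hlt⟩ := exists_netBenefit_half_lt ha (hc.2 h1)
    have := hmax δ hδ
    rw [h1] at this
    linarith
  · obtain ⟨δ, hδ, hlt⟩ := exists_netBenefit_gt ha ha' hc.1 h1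
    linarith [hmax δ hδ]

/-- The difference is `4 + 3s + s^2 (72 - 345s + 324s^2 + 261s^3) + 81s^7`, and the cubic stays
nonnegative; its minimum is near `0.37`. -/
theorem polynomial_bound {s : ℝ} (hs : 0 ≤ s) :
    400 * s ^ 3 < (4 + 3 * s + s ^ 3) * (1 + 9 * s ^ 2) ^ 2 := by
  have h : 0 ≤ 72 - 345 * s + 324 * s ^ 2 + 261 * s ^ 3 := by
    nlinarith [mul_nonneg (sq_nonneg (s - 37 / 100)) (show 0 ≤ s + 74 / 100 by linarith),
      sq_nonneg (s - 367 / 1000)]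
  have h1 : 0 ≤ s ^ 2 * (72 - 345 * s + 324 * s ^ 2 + 261 * s ^ 3) := by positivity
  have h2 : 0 ≤ 81 * s ^ 7 := by positivity
  nlinarith

/-- In areas no longer than `36 / 5` the midpoint is better than any other question. -/
theorem distancePayoff_lt_midPayoff (hη : 0 < η) {X d : ℝ} (h0 : 0 < X) (hX : X ≤ 36 / 5)
    (hd0 : 0 < d) (hd : d < X / 2) : distancePayoff η X d < midPayoff η X := by
  have hv := areaVar_pos hd0 (show d < X by linarith)
  rcases eq_or_lt_of_le (questionPayoff_nonneg hη hv.le (V := areaBenefit X d)) with h | h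
  · rw [distancePayoff, ← h]; exact midPayoff_pos hη h0 (by linarith)
  have hV := (benefit_pos_of_questionPayoff_pos hη hv.le h).1
  rw [← distancePayoff_half h0 (by linarith)]
  have hx : 0 < X - d := by linarith
  refine questionPayoff_lt hη (areaVar_pos (by linarith) (by linarith)) hv hV fun κ hκ hκ' => ?_
  rw [areaBenefit_sub h0, areaBenefit_sub h0, netBenefit, netBenefit, sub_half,
    optionPart_of_le (x := X / 2) (by linarith) (by linarith),
    optionPart_of_le (x := d) (by linarith) (by linarith)]
  set a := 1 - 3 * κ / X with ha
  -- Both `d` and `X / 2` are below `4`, so moving to the midpoint only trades the option value of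
  -- the long part for the quadratic gain.
  suffices hs : optionPart (X - d) < a * (X - 2 * d) ^ 2 / 2 by
    have : 2 * a * (X / 2 * (X / 2)) - 2 * a * (d * (X - d)) = a * (X - 2 * d) ^ 2 / 2 := by ring
    linarith
  -- This is the price bound `κ < V / (2v)` written in terms of `a`.
  have ha2 : 1 / 2 + (optionPart X - optionPart (X - d)) / (4 * (d * (X - d))) < a := by
    rw [lt_div_iff₀ (by positivity), areaBenefit_eq, optionPart_of_le hd0.le (by linarith), areaVar]
      at hκ'
    have h4 : κ * (2 * (d * (X - d) / X)) = (1 - a) * (4 * (d * (X - d))) / 6 := by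
      rw [ha]; field_simp; ring
    rw [h4] at hκ'
    have h5 : 0 < d * (X - d) := by positivity
    rw [← lt_sub_iff_add_lt', div_lt_iff₀ (by positivity)]
    linarith
  rcases le_or_gt (X - d) 4 with h4 | h4
  · have hF := optionPart_nonneg h0.le
    rw [optionPart_of_le hx.le h4] at ha2 ⊢
    have : 0 ≤ (optionPart X - 0) / (4 * (d * (X - d))) := by
      rw [sub_zero]; positivity
    have ha0 : 0 < a := by linarith
    have : 0 < X - 2 * d := by linarith
    positivity
  · have hch := optionSlope_mul_le hx (show X - d ≤ X by linarith)
    rw [sub_sub_cancel] at hch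
    -- Convexity replaces the chord by the tangent at `X - d`, so that only `s = rootPart (X - d)`
    -- remains; with `X ≤ 36/5` the claim becomes `polynomial_bound`.
    have h5 : optionSlope (X - d) / (4 * (X - d)) ≤
        (optionPart X - optionPart (X - d)) / (4 * (d * (X - d))) := by
      rw [div_le_div_iff₀ (by positivity) (by positivity)]
      nlinarith
    have h6 := eq_of_rootPart h4.le
    have h7 := rootPart_pos h4
    have h8 := rootPart_lt_one hx
    have h9 := mul_one_sub_rootPart_sq h4.le
    rw [optionSlope] at h5
    rw [optionPart_eq h4.le]
    have h10 : 2 * (X - d) - 36 / 5 ≤ X - 2 * d := by linarith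
    have hdx : X - 2 * d = X - d - d := by ring
    set x := X - d with hxdef
    set s := rootPart x
    have h11 : 0 < 1 - s ^ 2 := by nlinarith
    have h12 : 2 * (x - 1) * s / (4 * x) = s * (3 + s ^ 2) / 8 := by
      rw [h6]; field_simp; ring
    have h13 : (4 + 3 * s + s ^ 3) / 8 < a := by
      rw [h12] at h5; linarith
    have h14 : 2 * x - 36 / 5 = (4 / 5) * (1 + 9 * s ^ 2) / (1 - s ^ 2) := by
      rw [h6]; field_simp; ring
    have h15 : 0 < 2 * x - 36 / 5 := by rw [h14]; positivity
    have h16 : (4 / 5 * (1 + 9 * s ^ 2) / (1 - s ^ 2)) ^ 2 ≤ (X - 2 * d) ^ 2 := by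
      rw [← h14]; gcongr
    have h17 := polynomial_bound h7.le
    calc x ^ 2 * s ^ 3 = 400 * s ^ 3 * ((4 / 5 / (1 - s ^ 2)) ^ 2 / 16) := by
          rw [h6]; field_simp; norm_num
      _ < (4 + 3 * s + s ^ 3) * (1 + 9 * s ^ 2) ^ 2 * ((4 / 5 / (1 - s ^ 2)) ^ 2 / 16) := by gcongr
      _ = (4 + 3 * s + s ^ 3) / 8 * (4 / 5 * (1 + 9 * s ^ 2) / (1 - s ^ 2)) ^ 2 / 2 := by
          field_simp; norm_num
      _ ≤ a * (X - 2 * d) ^ 2 / 2 := by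
          have : 0 ≤ a := le_trans (by positivity) h13.le
          gcongr

theorem IsBestDistance.eq_half (hη : 0 < η) {X d : ℝ} (h0 : 0 < X) (hX : X ≤ 36 / 5)
    (h : IsBestDistance η X d) : d = X / 2 := by
  by_contra hne
  have h1 := distancePayoff_lt_midPayoff hη h0 hX (h.spec hη h0).1 (lt_of_le_of_ne h.1.2 hne)
  have h2 := h.2 (show X / 2 ∈ Icc 0 (X / 2) from ⟨by positivity, le_rfl⟩)
  rw [mem_ofPred_eq, distancePayoff_half h0 (by linarith)] at h2
  linarith

theorem isBestDistance_half (hη : 0 < η) {X : ℝ} (h0 : 0 < X) (hX : X ≤ 36 / 5) :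
    IsBestDistance η X (X / 2) := by
  obtain ⟨d, hd⟩ := exists_isBestDistance hη h0
  rwa [hd.eq_half hη h0 hX] at hd

/-! ### The cutoffs, with `q = 1` -/

/-- The maximal payoff in an area of length `X`. -/
noncomputable def bestPayoff (η X : ℝ) : ℝ := sSup (distancePayoff η X '' Icc 0 (X / 2))

theorem IsBestDistance.payoff_eq {X d : ℝ} (h : IsBestDistance η X d) :
    distancePayoff η X d = bestPayoff η X := by
  refine (IsGreatest.csSup_eq ⟨mem_image_of_mem _ h.1, ?_⟩).symm
  rintro _ ⟨d', hd', rfl⟩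
  exact h.2 hd'

theorem distancePayoff_le_bestPayoff (hη : 0 < η) {X d : ℝ} (h0 : 0 < X) (hd : d ∈ Icc 0 (X / 2)) :
    distancePayoff η X d ≤ bestPayoff η X := by
  obtain ⟨d', h⟩ := exists_isBestDistance hη h0
  rw [← h.payoff_eq]
  exact h.2 hd

theorem bestPayoff_eq_midPayoff (hη : 0 < η) {X : ℝ} (h0 : 0 < X) (hX : X ≤ 36 / 5) :
    bestPayoff η X = midPayoff η X := by
  rw [← (isBestDistance_half hη h0 hX).payoff_eq, distancePayoff_half h0 (by linarith)]

theorem midPayoff_le_bestPayoff (hη : 0 < η) {X : ℝ} (h0 : 0 < X) (hX : X ≤ 8) :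
    midPayoff η X ≤ bestPayoff η X := by
  rw [← distancePayoff_half h0 hX]
  exact distancePayoff_le_bestPayoff hη h0 ⟨by positivity, le_rfl⟩

/-- In long areas the payoff from a fixed short distance decreases in the length of the area. -/
theorem distancePayoff_lt_of_lt (hη : 0 < η) {X Y d : ℝ} (hX : 36 / 5 ≤ X) (hXY : X < Y)
    (h0 : 0 < d) (hd : d < 18 / 5) (hV : 0 < areaBenefit Y d) :
    distancePayoff η Y d < distancePayoff η X d := by
  have hder : ∀ x, d < x → HasDerivAt (fun x => areaBenefit x d)
      ((2 * d + optionSlope (x - d) - optionSlope x) / 6) x := by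
    intro x hx
    have h1 : HasDerivAt (fun x => x - d) 1 x := (hasDerivAt_id x).sub_const d
    have h2 : HasDerivAt (fun x => optionPart (x - d)) (optionSlope (x - d) * 1) x :=
      (hasDerivAt_optionPart (by linarith)).comp x h1
    have h3 := (((h1.const_mul (2 * d)).add_const (optionPart d)).add h2).sub
      (hasDerivAt_optionPart (show 0 < x by linarith))
    have h4 := h3.div_const 6
    refine (h4.congr_deriv (by ring)).congr_of_eventuallyEq
      (Filter.Eventually.of_forall fun x => ?_)
    simp only [Pi.add_apply, Pi.sub_apply]
    rw [areaBenefit_eq]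
  have hanti : AntitoneOn (fun x => areaBenefit x d) (Ici (36 / 5)) := by
    refine antitoneOn_of_deriv_nonpos (convex_Ici _) (fun x hx => ?_) (fun x hx => ?_) fun x hx => ?_
    · have := mem_Ici.1 hx
      exact (hder x (by linarith)).continuousAt.continuousWithinAt
    · rw [interior_Ici] at hx
      have := mem_Ioi.1 hx
      exact (hder x (by linarith)).differentiableAt.differentiableWithinAt
    · rw [interior_Ici] at hx
      have hx' := mem_Ioi.1 hx
      rw [(hder x (by linarith)).deriv]
      -- If the long part is at most `4`, the slope at `x` is at least `124/15`, which exceeds `2 *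
      -- 18/5`. Otherwise `F'' > 2` on `[x - d, x]` suffices.
      rcases le_total (x - d) 4 with h | h
      · rw [optionSlope_of_le (by linarith) h]
        have h1 := optionSlope_monotoneOn (show (36 / 5 : ℝ) ∈ Ioi 0 by norm_num)
          (show x ∈ Ioi 0 from lt_trans (by norm_num) hx') hx'.le
        have h2 : optionSlope (36 / 5) = 124 / 15 := by
          rw [optionSlope, rootPart_four_div (s := 2 / 3) (by norm_num) (by norm_num)]; norm_num
        rw [h2] at h1
        linarith
      · have h1 := optionSlope_sub_two_mul_strictMonoOn.monotoneOn h (show 4 ≤ x by linarith)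
          (by linarith)
        linarith
  refine questionPayoff_lt_of_lt hη (areaVar_pos h0 (by linarith)) hV
    (hanti hX (hX.trans hXY.le) hXY.le) ?_
  have hX0 : 0 < X := by linarith
  have hY0 : 0 < Y := by linarith
  rw [areaVar, areaVar, div_lt_div_iff₀ hX0 hY0]
  nlinarith [mul_pos h0 h0, mul_pos (mul_pos h0 h0) (sub_pos.2 hXY)]

/-- Up to `36/5` this is the peak of the midpoint payoff. Beyond, the best distance of the longer
area is either short, and then pays more in the shorter area, or a midpoint below length `8`, where
the midpoint payoff already falls. -/
theorem exists_bestPayoff_peak (hη : 0 < η) : ∃ m, ratioPeak < m ∧ m ≤ 25 / 4 ∧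
    StrictMonoOn (bestPayoff η) (Ioc 0 m) ∧ StrictAntiOn (bestPayoff η) (Ici m) := by
  obtain ⟨m, hpk, hm, hmono, hanti⟩ := exists_midPayoff_peak hη
  have h4 := four_lt_ratioPeak
  refine ⟨m, hpk, hm, hmono.congr fun x hx => ?_, ?_⟩
  · exact (bestPayoff_eq_midPayoff hη hx.1 (by linarith [hx.2])).symm
  have h1 : StrictAntiOn (bestPayoff η) (Icc m (36 / 5)) :=
    (hanti.mono (Icc_subset_Icc_right (by norm_num))).congr fun x hx =>
      (bestPayoff_eq_midPayoff hη (by linarith [hx.1]) hx.2).symm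
  have h2 : StrictAntiOn (bestPayoff η) (Ici (36 / 5)) := by
    intro X hX Y hY hXY
    have hX' := mem_Ici.1 hX
    have hY0 : 0 < Y := by linarith
    obtain ⟨d, hd⟩ := exists_isBestDistance hη hY0
    rcases hd.lt_or_eq hη hY0 with h | ⟨h, h8⟩
    · have hs := hd.spec hη hY0
      rw [← hd.payoff_eq]
      exact (distancePayoff_lt_of_lt hη hX' hXY hs.1 h hs.2.1).trans_le
        (distancePayoff_le_bestPayoff hη (by linarith) ⟨hs.1.le, by linarith⟩)
    · rw [← hd.payoff_eq, h, distancePayoff_half hY0 h8.le]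
      exact (hanti ⟨by linarith, by linarith⟩ ⟨by linarith, h8.le⟩ hXY).trans_le
        (midPayoff_le_bestPayoff hη (by linarith) (by linarith))
  have := h1.union h2 (isGreatest_Icc (by linarith)) isLeast_Ici
  rwa [Icc_union_Ici_eq_Ici (by linarith)] at this

/-! ### Questions beyond the frontier and the cutoffs -/

/-- The maximal payoff from a question at distance `d` beyond the frontier. -/
noncomputable def frontierPayoff (η d : ℝ) : ℝ := questionPayoff η (areaValue d) d

/-- Distances beyond `3` bring no more benefit and more variance. Below `1` the price is under
`1/2`, and `d - d^2/6 - κ d` still increases up to `1`. -/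
theorem exists_frontierPayoff_max (hη : 0 < η) : ∃ d, d ∈ Icc (1 : ℝ) 3 ∧
    ∀ d', 0 < d' → frontierPayoff η d' ≤ frontierPayoff η d := by
  have hc : ContinuousOn (frontierPayoff η) (Icc 1 3) := fun x hx =>
    continuousAt_questionPayoff hη
      (continuousOn_areaValue.mono (fun x hx => le_trans zero_le_one hx.1) x hx)
      continuousWithinAt_id (show x ≠ 0 by linarith [hx.1])
  obtain ⟨d, hd, hmax⟩ := isCompact_Icc.exists_isMaxOn (nonempty_Icc.2 (show (1 : ℝ) ≤ 3 by norm_num)) hc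
  refine ⟨d, hd, fun d' hd' => ?_⟩
  rcases le_or_gt d' 3 with h3 | h3
  · rcases lt_or_ge d' 1 with h1 | h1
    · refine le_trans (le_of_lt ?_) (hmax (show (1 : ℝ) ∈ Icc 1 3 by norm_num))
      have hV : areaValue d' = d' - d' ^ 2 / 6 := areaValue_of_le hd'.le (by linarith)
      have hV1 : areaValue 1 = 5 / 6 := by
        rw [areaValue_of_le (by norm_num) (by norm_num)]; norm_num
      refine questionPayoff_lt hη one_pos hd' (by rw [hV]; nlinarith) fun κ hκ hκ' => ?_
      rw [hV, lt_div_iff₀ (by positivity)] at hκ'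
      rw [hV, hV1]
      have : κ < (1 - d' / 6) / 2 := by
        by_contra hcon
        nlinarith [mul_le_mul_of_nonneg_right (not_lt.1 hcon) hd'.le]
      nlinarith [mul_lt_mul_of_pos_right this (sub_pos.2 h1)]
    · exact hmax ⟨h1, h3⟩
  · have hle := areaValue_antitoneOn self_mem_Ici (show 3 ≤ d' from h3.le) h3.le
    refine le_trans ?_ (hmax (show (3 : ℝ) ∈ Icc 1 3 by norm_num))
    rcases eq_or_lt_of_le (questionPayoff_nonneg hη hd'.le (V := areaValue d')) with h | h
    · rw [frontierPayoff, ← h]; exact questionPayoff_nonneg hη (by norm_num)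
    · exact (questionPayoff_lt_of_lt hη (by norm_num)
        (benefit_pos_of_questionPayoff_pos hη hd'.le h).1 hle h3).le

/-- The length at which the best question in an area is as good as the best question beyond the
frontier. -/
theorem exists_expansion_cutoff (hη : 0 < η) : ∃ d X, d ∈ Icc (1 : ℝ) 3 ∧
    (∀ d', 0 < d' → frontierPayoff η d' ≤ frontierPayoff η d) ∧ 0 < frontierPayoff η d ∧
    2 < X ∧ X < ratioPeak ∧ bestPayoff η X = frontierPayoff η d ∧
    (∀ Y, 0 < Y → Y < X → bestPayoff η Y < frontierPayoff η d) ∧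
    ∀ Y, X < Y → frontierPayoff η d < bestPayoff η Y := by
  obtain ⟨d, hd, hmax⟩ := exists_frontierPayoff_max hη
  obtain ⟨h3, h4⟩ := ratioPeak_bounds
  obtain ⟨h5, h6⟩ := midRatio_ratioPeak_bounds
  have hV : areaValue d = d - d ^ 2 / 6 := areaValue_of_le (by linarith [hd.1]) (by linarith [hd.2])
  have hV0 : 0 < areaValue d := by rw [hV]; nlinarith [hd.1, hd.2]
  have hd0 : 0 < d := by linarith [hd.1]
  have hW : 0 < frontierPayoff η d := questionPayoff_pos hη hV0 hd0
  -- The midpoint of an area of length `2` has ratio `2/3` and variance `1/2`; distance `1` beyond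
  -- the frontier has ratio `5/6` and variance `1`.
  have hlow : midPayoff η 2 < frontierPayoff η d := by
    refine lt_of_lt_of_le ?_ (hmax 1 one_pos)
    rw [midPayoff, midRatio_of_le (by norm_num) (by norm_num), frontierPayoff, questionPayoff,
      areaValue_of_le (by norm_num) (by norm_num)]
    have h1 := unitPayoff_strictMonoOn hη (show (0 : ℝ) ≤ 2 / 3 by norm_num)
      (show (0 : ℝ) ≤ (1 - 1 ^ 2 / 6) / 1 by norm_num) (by norm_num)
    have h2 := unitPayoff_pos hη (show (0 : ℝ) < 2 / 3 by norm_num)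
    linarith
  -- The frontier benefit is at most `3/2`, below the midpoint's `1.56`. Where the midpoint has the
  -- larger variance, the price bound `1/2` and `d ≥ 1` limit its cost.
  have hhigh : frontierPayoff η d < midPayoff η ratioPeak := by
    rw [midPayoff_eq_questionPayoff (by linarith)]
    refine questionPayoff_lt hη (by linarith) hd0 hV0 fun κ hκ hκ' => ?_
    rw [hV, lt_div_iff₀ (by positivity)] at hκ'
    rw [hV]
    have hκ2 : κ < 1 / 2 := by
      by_contra hcon
      nlinarith [mul_le_mul_of_nonneg_right (not_lt.1 hcon) hd0.le]
    have h7 : 156 / 100 < ratioPeak / 4 * midRatio ratioPeak := by nlinarith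
    rcases le_total (ratioPeak / 4) d with h | h
    · nlinarith [mul_nonneg hκ.le (sub_nonneg.2 h), sq_nonneg (d - 3)]
    · nlinarith [mul_nonneg (sub_nonneg.2 hκ2.le) (sub_nonneg.2 h), hd.1]
  obtain ⟨X, hX, hXe⟩ := intermediate_value_Ioo (by linarith)
    ((continuousOn_midPayoff hη).mono fun x (hx : x ∈ Icc 2 ratioPeak) =>
      lt_of_lt_of_le two_pos hx.1) ⟨hlow, hhigh⟩
  have hX1 := hX.1
  have hX2 := hX.2
  have hbX : bestPayoff η X = frontierPayoff η d := by
    rw [bestPayoff_eq_midPayoff hη (by linarith) (by linarith), hXe]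
  obtain ⟨m, hm1, hm2, hmono, hanti⟩ := exists_bestPayoff_peak hη
  refine ⟨d, X, hd, hmax, hW, hX1, hX2, hbX, fun Y hY0 hY => ?_, fun Y hY => ?_⟩
  · rw [← hbX]
    exact hmono ⟨hY0, by linarith⟩ ⟨by linarith, by linarith⟩ hY
  · rcases le_total Y m with h | h
    · rw [← hbX]
      exact hmono ⟨by linarith, by linarith⟩ ⟨by linarith, h⟩ hY
    -- Past the peak the payoff at `Y` exceeds that at `Y + 6`, an area long enough for distance `d`
    -- to have at least the frontier's benefit with less variance.
    · have h8 : bestPayoff η (Y + 6) < bestPayoff η Y :=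
        hanti h (show m ≤ Y + 6 by linarith) (by linarith)
      refine lt_of_lt_of_le ?_ h8.le
      refine lt_of_lt_of_le ?_ (distancePayoff_le_bestPayoff hη (by linarith)
        (show d ∈ Icc 0 ((Y + 6) / 2) from ⟨hd0.le, by linarith [hd.2]⟩))
      refine questionPayoff_lt_of_lt hη (areaVar_pos hd0 (by linarith [hd.2])) hV0
        (areaValue_le_areaBenefit (by linarith) hd0.le hd.2) ?_
      rw [areaVar, div_lt_iff₀ (by linarith)]
      nlinarith [mul_pos hd0 hd0]

/-- The longest area whose midpoint is an optimal question. -/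
theorem exists_distance_cutoff (hη : 0 < η) : ∃ X, 36 / 5 ≤ X ∧ X < 8 ∧
    IsBestDistance η X (X / 2) ∧ ∀ Y d, X < Y → IsBestDistance η Y d → d < 18 / 5 := by
  set S := {X : ℝ | 36 / 5 ≤ X ∧ IsBestDistance η X (X / 2)} with hS
  have h8 : ∀ X ∈ S, X < 8 := by
    intro X hX
    have h1 : 36 / 5 ≤ X := hX.1
    rcases hX.2.lt_or_eq hη (by linarith) with h | h
    · linarith
    · exact h.2
  have hbdd : BddAbove S := ⟨8, fun X hX => (h8 X hX).le⟩
  have hne : S.Nonempty := ⟨36 / 5, le_rfl, isBestDistance_half hη (by norm_num) le_rfl⟩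
  -- A question strictly better than the midpoint at a limit length would, by continuity, also beat
  -- it at nearby lengths in `S`. So the supremum of `S` is attained.
  have hclosed : IsClosed S := by
    refine isClosed_of_closure_subset fun X hX => ?_
    have hX1 : X ∈ Ici (36 / 5 : ℝ) :=
      closure_minimal (fun Y (hY : Y ∈ S) => hY.1) isClosed_Ici hX
    have hX' := mem_Ici.1 hX1
    have hX0 : 0 < X := by linarith
    rw [mem_closure_iff_frequently] at hX
    refine ⟨hX', ⟨by positivity, le_rfl⟩, fun d hd => ?_⟩
    rw [mem_ofPred_eq]
    by_contra! hlt
    have hd0 : 0 < d := by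
      rcases eq_or_lt_of_le hd.1 with h | h
      · rw [← h, distancePayoff_zero] at hlt
        exact absurd hlt (not_lt.2 (distancePayoff_nonneg hη (by positivity) (by linarith)))
      · exact h
    have hdX : d < X / 2 := lt_of_le_of_ne hd.2 fun h => by rw [h] at hlt; exact lt_irrefl _ hlt
    have hcont : ∀ f : ℝ → ℝ, ContinuousAt f X → 0 < f X → f X < X →
        ContinuousAt (fun Y => distancePayoff η Y (f Y)) X := by
      intro f hf h0 h1
      rw [← continuousWithinAt_univ] at hf ⊢
      refine continuousAt_questionPayoff hη ?_ ?_ (areaVar_pos h0 h1).ne'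
      · unfold areaBenefit
        exact ((((continuousAt_areaValue h0).comp_continuousWithinAt hf)).add
          ((continuousAt_areaValue (show 0 < X - f X by linarith)).comp_continuousWithinAt
            (continuousWithinAt_id.sub hf) (f := fun Y => Y - f Y))).sub
          (continuousAt_areaValue hX0).continuousWithinAt
      · unfold areaVar
        exact (hf.mul (continuousWithinAt_id.sub hf)).div continuousWithinAt_id hX0.ne'
    have h1 := hcont (fun _ => d) continuousAt_const hd0 (by linarith)
    have h2 := hcont (fun Y => Y / 2) (by fun_prop) (by positivity) (by linarith)
    have hev := h2.eventually_lt h1 hlt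
    have hev2 : ∀ᶠ Y in nhds X, d < Y / 2 :=
      (show ContinuousAt (fun Y : ℝ => Y / 2) X by fun_prop).eventually_const_lt hdX
    obtain ⟨Y, hY, hY1, hY2⟩ := (hX.and_eventually (hev.and hev2)).exists
    exact absurd (hY.2.2 ⟨hd0.le, hY2.le⟩) (not_le.2 hY1)
  have hmem := hclosed.csSup_mem hne hbdd
  refine ⟨sSup S, hmem.1, h8 _ hmem, hmem.2, fun Y d hY hd => ?_⟩
  have h1 : 36 / 5 ≤ sSup S := hmem.1
  rcases hd.lt_or_eq hη (by linarith) with h | ⟨h, -⟩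
  · exact h
  · exact absurd (le_csSup hbdd ⟨by linarith, h ▸ hd⟩) (not_le.2 hY)

/-- If the long part is at most `4`, `4d (X - d) ≤ X^2` bounds the ratio by `midRatio X`. Otherwise
the secants through `X` of the convex `F x - x^2` give a bound of `4/3`, below the peak ratio. -/
theorem areaBenefit_div_areaVar_lt {X d : ℝ} (hX : 36 / 5 ≤ X) (h0 : 0 < d) (hd : d < 18 / 5) :
    areaBenefit X d / areaVar X d < midRatio ratioPeak := by
  have hX0 : 0 < X := by linarith
  have hx : 0 < X - d := by linarith
  have hr : areaBenefit X d / areaVar X d =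
      X / 3 - X * (optionPart X - optionPart (X - d)) / (6 * (d * (X - d))) := by
    rw [areaBenefit_eq, areaVar, optionPart_of_le h0.le (by linarith)]
    field_simp; ring
  rw [hr]
  rcases le_total (X - d) 4 with h4 | h4
  · obtain ⟨hp, hp'⟩ := ratioPeak_bounds
    refine lt_of_le_of_lt ?_ (midRatio_lt_of_ne hX0 (by linarith))
    rw [optionPart_of_le hx.le h4, midRatio, sub_zero]
    have hF := optionPart_nonneg hX0.le
    have : 2 * optionPart X / (3 * X) ≤ X * optionPart X / (6 * (d * (X - d))) := by
      rw [div_le_div_iff₀ (by positivity) (by positivity)]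
      nlinarith [mul_nonneg hF (sq_nonneg (X - 2 * d))]
    linarith
  · obtain ⟨hp, hp'⟩ := midRatio_ratioPeak_bounds
    refine lt_of_le_of_lt ?_ (show (4 / 3 : ℝ) < midRatio ratioPeak by linarith)
    have hX4 : 4 < X := by linarith
    have hsec : (X + (X - d) + X * rootPart X - (X + 4)) * d ≤ optionPart X - optionPart (X - d) := by
      have hconv := optionPart_sub_sq_convexOn.secant_mono (a := X) (x := 4) (y := X - d)
        (show 4 ≤ X by linarith) self_mem_Ici h4 (by linarith) (by linarith) h4
      have h1 : (optionPart 4 - 4 ^ 2 - (optionPart X - X ^ 2)) / (4 - X) =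
          X * rootPart X - (X + 4) := by
        rw [optionPart_of_le (by norm_num) le_rfl, optionPart,
          div_eq_iff (show 4 - X ≠ 0 by linarith)]
        ring
      have h2 : (optionPart (X - d) - (X - d) ^ 2 - (optionPart X - X ^ 2)) / (X - d - X) =
          (optionPart X - optionPart (X - d)) / d - (X + (X - d)) := by
        rw [show X - d - X = -d by ring]
        field_simp; ring
      rw [h1, h2, le_sub_iff_add_le, le_div_iff₀ h0] at hconv
      linarith
    have hs : 2 / 3 ≤ rootPart X := by
      rw [← rootPart_four_div (s := 2 / 3) (X := 36 / 5) (by norm_num) (by norm_num)]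
      exact rootPart_mono (by norm_num) hX
    have hs1 := rootPart_lt_one hX0
    have h9 := mul_one_sub_rootPart_sq hX4.le
    set s := rootPart X
    have hXs : 0 ≤ X * s - 4 := by nlinarith
    have h5 : X * (1 + (s - 4 / X)) / 6 ≤
        X * (optionPart X - optionPart (X - d)) / (6 * (d * (X - d))) := by
      rw [div_le_div_iff₀ (by norm_num) (by positivity)]
      have h6 : (1 + (s - 4 / X)) * (d * (X - d)) ≤ optionPart X - optionPart (X - d) := by
        refine le_trans ?_ hsec
        have : (s - 4 / X) * (X - d) ≤ X * s - 4 := by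
          have h7 : 0 ≤ s - 4 / X := by
            have : s - 4 / X = (X * s - 4) / X := by field_simp
            rw [this]; positivity
          calc (s - 4 / X) * (X - d) ≤ (s - 4 / X) * X := by gcongr; linarith
            _ = X * s - 4 := by field_simp
        nlinarith
      nlinarith
    have h8 : X * (1 + (s - 4 / X)) / 6 = X * (1 + s) / 6 - 2 / 3 := by field_simp; ring
    rw [h8] at h5
    nlinarith

/-- The optimal probability is a strictly increasing function of a positive benefit-variance ratio,
so this yields the unique maximum of the probability. -/
theorem IsBestDistance.ratio_lt (hη : 0 < η) {X d : ℝ} (h0 : 0 < X) (hne : X ≠ ratioPeak)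
    (h : IsBestDistance η X d) : areaBenefit X d / areaVar X d < midRatio ratioPeak := by
  have hmid : X ≤ 8 → d = X / 2 → areaBenefit X d / areaVar X d < midRatio ratioPeak := by
    intro h8 hd
    rw [hd, areaBenefit_half h0 h8, areaVar_half h0, mul_div_cancel_left₀ _ (by positivity)]
    exact midRatio_lt_of_ne h0 hne
  rcases le_total X (36 / 5) with hX | hX
  · exact hmid (by linarith) (h.eq_half hη h0 hX)
  · rcases h.lt_or_eq hη h0 with h1 | ⟨h1, h2⟩
    · exact areaBenefit_div_areaVar_lt hX (h.spec hη h0).1 h1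
    · exact hmid h2.le h1

theorem IsBestDistance.ratio_eq (hη : 0 < η) {d : ℝ} (h : IsBestDistance η ratioPeak d) :
    areaBenefit ratioPeak d / areaVar ratioPeak d = midRatio ratioPeak := by
  obtain ⟨h1, h2⟩ := ratioPeak_bounds
  have h0 : 0 < ratioPeak := by linarith
  rw [h.eq_half hη h0 (by linarith), areaBenefit_half h0 (by linarith), areaVar_half h0,
    mul_div_cancel_left₀ _ (by positivity)]

/-! ### The variance of the conjecture -/

variable {K : Finset ℝ} {a b x z : ℝ}

theorem max'_leftOf (ha : a ∈ K) (haz : a ≤ z) (h : ∀ k ∈ K, k ≤ z → k ≤ a)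
    (hl : (leftOf K z).Nonempty) : (leftOf K z).max' hl = a := by
  refine le_antisymm (Finset.max'_le _ _ _ fun k hk => ?_) (Finset.le_max' _ _ ?_)
  · rw [leftOf, Finset.mem_filter] at hk
    exact h k hk.1 hk.2
  · rw [leftOf, Finset.mem_filter]
    exact ⟨ha, haz⟩

theorem min'_rightOf (hb : b ∈ K) (hzb : z < b) (h : ∀ k ∈ K, z < k → b ≤ k)
    (hr : (rightOf K z).Nonempty) : (rightOf K z).min' hr = b := by
  refine le_antisymm (Finset.min'_le _ _ ?_) (Finset.le_min' _ _ _ fun k hk => ?_)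
  · rw [rightOf, Finset.mem_filter]
    exact ⟨hb, hzb⟩
  · rw [rightOf, Finset.mem_filter] at hk
    exact h k hk.1 hk.2

theorem IsArea.conjVar_eq (h : IsArea K a b) (haz : a ≤ z) (hzb : z < b) :
    conjVar K z = (b - z) * (z - a) / (b - a) := by
  obtain ⟨ha, hb, -, hk⟩ := h
  have hl : (leftOf K z).Nonempty := ⟨a, Finset.mem_filter.2 ⟨ha, haz⟩⟩
  have hr : (rightOf K z).Nonempty := ⟨b, Finset.mem_filter.2 ⟨hb, hzb⟩⟩
  have h1 := max'_leftOf ha haz (fun k hkK hkz => (hk k hkK).resolve_right (by linarith)) hl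
  have h2 := min'_rightOf hb hzb (fun k hkK hkz => (hk k hkK).resolve_left (by linarith)) hr
  rw [conjVar, dif_pos hl, dif_pos hr, h1, h2]

theorem conjVar_of_max_le (ha : a ∈ K) (hk : ∀ k ∈ K, k ≤ a) (haz : a ≤ z) :
    conjVar K z = z - a := by
  have hl : (leftOf K z).Nonempty := ⟨a, Finset.mem_filter.2 ⟨ha, haz⟩⟩
  have hr : ¬ (rightOf K z).Nonempty := by
    rintro ⟨k, hkK⟩
    rw [rightOf, Finset.mem_filter] at hkK
    linarith [hk k hkK.1, hkK.2]
  rw [conjVar, dif_pos hl, dif_neg hr, max'_leftOf ha haz (fun k hkK _ => hk k hkK) hl]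

theorem conjVar_of_lt_min (hb : b ∈ K) (hk : ∀ k ∈ K, b ≤ k) (hzb : z < b) :
    conjVar K z = b - z := by
  have hr : (rightOf K z).Nonempty := ⟨b, Finset.mem_filter.2 ⟨hb, hzb⟩⟩
  have hl : ¬ (leftOf K z).Nonempty := by
    rintro ⟨k, hkK⟩
    rw [leftOf, Finset.mem_filter] at hkK
    linarith [hk k hkK.1, hkK.2]
  rw [conjVar, dif_neg hl, dif_pos hr, min'_rightOf hb hzb (fun k hkK _ => hk k hkK) hr]

/-- A question lies to the left of all known questions, to the right of them, or in an area. -/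
theorem exists_location (hK : K.Nonempty) (z : ℝ) :
    (∃ b ∈ K, (∀ k ∈ K, b ≤ k) ∧ z < b) ∨ (∃ a ∈ K, (∀ k ∈ K, k ≤ a) ∧ a ≤ z) ∨
      ∃ a b, IsArea K a b ∧ a ≤ z ∧ z < b := by
  by_cases hl : (leftOf K z).Nonempty
  · have h1 := Finset.max'_mem _ hl
    have h1' := Finset.mem_filter.1 h1
    by_cases hr : (rightOf K z).Nonempty
    · have h2 := Finset.min'_mem _ hr
      have h2' := Finset.mem_filter.1 h2
      refine Or.inr (Or.inr ⟨_, _, ⟨h1'.1, h2'.1, h1'.2.trans_lt h2'.2, fun k hk => ?_⟩, h1'.2, h2'.2⟩)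
      rcases le_or_gt k z with h | h
      · exact Or.inl (Finset.le_max' _ _ (Finset.mem_filter.2 ⟨hk, h⟩))
      · exact Or.inr (Finset.min'_le _ _ (Finset.mem_filter.2 ⟨hk, h⟩))
    · refine Or.inr (Or.inl ⟨_, h1'.1, fun k hk => ?_, h1'.2⟩)
      refine Finset.le_max' _ _ (Finset.mem_filter.2 ⟨hk, ?_⟩)
      by_contra h
      exact hr ⟨k, Finset.mem_filter.2 ⟨hk, not_le.1 h⟩⟩
  · have hz : ∀ k ∈ K, z < k := fun k hk => by
      by_contra h
      exact hl ⟨k, Finset.mem_filter.2 ⟨hk, not_lt.1 h⟩⟩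
    exact Or.inl ⟨K.min' hK, K.min'_mem hK, fun k hk => K.min'_le k hk, hz _ (K.min'_mem hK)⟩

theorem conjVar_nonneg (K : Finset ℝ) (z : ℝ) : 0 ≤ conjVar K z := by
  rcases K.eq_empty_or_nonempty with rfl | hK
  · simp [conjVar, leftOf, rightOf]
  · rcases exists_location hK z with ⟨b, hb, hk, hz⟩ | ⟨a, ha, hk, hz⟩ | ⟨a, b, h, hz, hz'⟩
    · rw [conjVar_of_lt_min hb hk hz]; linarith
    · rw [conjVar_of_max_le ha hk hz]; linarith
    · rw [h.conjVar_eq hz hz']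
      exact div_nonneg (mul_nonneg (by linarith) (by linarith)) (by linarith)

theorem conjVar_of_mem (h : z ∈ K) : conjVar K z = 0 := by
  rcases exists_location ⟨z, h⟩ z with ⟨b, hb, hk, hz⟩ | ⟨a, ha, hk, hz⟩ | ⟨a, b, hA, hz, hz'⟩
  · linarith [hk z h]
  · rw [conjVar_of_max_le ha hk hz]
    linarith [hk z h]
  · rw [hA.conjVar_eq hz hz']
    have : z = a := le_antisymm ((hA.2.2.2 z h).resolve_right (by linarith)) hz
    simp [this]

/-- The variance is a function of `z` and the set `leftOf K z`. That set takes finitely many values,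
each on a measurable set, and for each value the formula is measurable in `z`. -/
theorem measurable_conjVar (K : Finset ℝ) : Measurable (conjVar K) := by
  classical
  let c : ℝ → K.powerset := fun z => ⟨leftOf K z, Finset.mem_powerset.2 (Finset.filter_subset _ _)⟩
  have hc : @Measurable _ _ _ ⊤ c := by
    let _ : MeasurableSpace K.powerset := ⊤
    refine measurable_to_countable' fun S => ?_
    have : c ⁻¹' {S} = ⋂ k ∈ K, {z | k ≤ z ↔ k ∈ S.1} := by
      ext z
      simp only [mem_preimage, mem_singleton_iff, mem_iInter, Subtype.ext_iff, c, leftOf]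
      constructor
      · intro h k hk
        simp [← h, hk]
      · intro h
        ext k
        rw [Finset.mem_filter]
        constructor
        · exact fun hk => (h k hk.1).1 hk.2
        · intro hk
          have hkK := Finset.mem_powerset.1 S.2 hk
          exact ⟨hkK, (h k hkK).2 hk⟩
    rw [this]
    refine Finset.measurableSet_biInter _ fun k _ => ?_
    by_cases hk : k ∈ S.1
    · simp only [hk, iff_true]; exact measurableSet_Ici
    · simp only [hk, iff_false, not_le]; exact measurableSet_Iio
  let H : K.powerset × ℝ → ℝ := fun p =>
    if hl : p.1.1.Nonempty then
      if hr : (K \ p.1.1).Nonempty then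
        ((K \ p.1.1).min' hr - p.2) * (p.2 - p.1.1.max' hl) / ((K \ p.1.1).min' hr - p.1.1.max' hl)
      else p.2 - p.1.1.max' hl
    else
      if hr : (K \ p.1.1).Nonempty then (K \ p.1.1).min' hr - p.2 else 0
  let _ : MeasurableSpace K.powerset := ⊤
  have hH : Measurable H := by
    refine measurable_from_prod_countable_right fun S => ?_
    simp only [H]
    split_ifs with hl hr hr
    · exact (show ∀ u v : ℝ, Measurable fun y : ℝ => (u - y) * (y - v) / (u - v) by
        intro u v; fun_prop) ((K \ S.1).min' hr) (S.1.max' hl)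
    · exact measurable_id'.sub_const (S.1.max' hl)
    · exact measurable_id'.const_sub ((K \ S.1).min' hr)
    · exact measurable_const
  have hr : ∀ z, rightOf K z = K \ leftOf K z := by
    intro z
    ext k
    simp only [rightOf, leftOf, Finset.mem_filter, Finset.mem_sdiff]
    constructor
    · exact fun h => ⟨h.1, fun h' => absurd h'.2 (not_le.2 h.2)⟩
    · exact fun h => ⟨h.1, not_le.1 fun h' => h.2 ⟨h.1, h'⟩⟩
  have : conjVar K = H ∘ fun z => (c z, z) := by
    ext z
    simp only [conjVar, Function.comp, H, c, hr]
  rw [this]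
  exact hH.comp (hc.prodMk measurable_id)

/-! ### The value of knowledge -/

theorem integral_decisionPayoff (q c m : ℝ) (v : NNReal) :
    ∫ t, decisionPayoff q (some c) t ∂gaussianReal m v = 1 - ((c - m) ^ 2 + v) / q := by
  have hL2 : MemLp id 2 (gaussianReal m v) := memLp_id_gaussianReal 2
  have hi : Integrable (fun t : ℝ => t) (gaussianReal m v) := hL2.integrable (by norm_num)
  have hi2 : Integrable (fun t : ℝ => t ^ 2) (gaussianReal m v) := hL2.integrable_sq
  have hv := variance_eq_sub hL2
  rw [variance_id_gaussianReal] at hv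
  have hm : ∫ t, t ∂gaussianReal m v = m := integral_id_gaussianReal
  have h2 : ∫ t, t ^ 2 ∂gaussianReal m v = v + m ^ 2 := by
    simp only [id, Pi.pow_apply, hm] at hv
    linarith
  have he : ∀ t, decisionPayoff q (some c) t =
      (1 - c ^ 2 / q) + (2 * c / q) * t - (1 / q) * t ^ 2 := by
    intro t; simp only [decisionPayoff]; ring
  simp only [he]
  have e1 : ∫ t, ((1 - c ^ 2 / q) + (2 * c / q) * t - (1 / q) * t ^ 2) ∂gaussianReal m v = _ :=
    integral_sub ((integrable_const _).add (hi.const_mul _)) (hi2.const_mul _)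
  have e2 : ∫ t, ((1 - c ^ 2 / q) + (2 * c / q) * t) ∂gaussianReal m v = _ :=
    integral_add (integrable_const _) (hi.const_mul _)
  rw [e1, e2, integral_const_mul, integral_const_mul, hm, h2]
  simp
  ring

/-- The expected loss of an action is its squared bias plus the variance, so the conjectured mean is
the best proactive action. From here on the answers `y` play no role. -/
theorem iSup_decisionPayoff {q : ℝ} (hq : 0 < q) (y : ℝ → ℝ) (K : Finset ℝ) (x : ℝ) :
    ⨆ act : Option ℝ, ∫ t, decisionPayoff q act t ∂(conjecture y K x) =
      max 0 (1 - conjVar K x / q) := by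
  have hnone : ∫ t, decisionPayoff q none t ∂(conjecture y K x) = 0 := by simp [decisionPayoff]
  have hsome : ∀ c, ∫ t, decisionPayoff q (some c) t ∂(conjecture y K x) =
      1 - ((c - conjMean y K x) ^ 2 + conjVar K x) / q := by
    intro c
    rw [conjecture, integral_decisionPayoff, Real.coe_toNNReal _ (conjVar_nonneg K x)]
  have hle : ∀ act, ∫ t, decisionPayoff q act t ∂(conjecture y K x) ≤
      max 0 (1 - conjVar K x / q) := by
    rintro (_ | c)
    · rw [hnone]; exact le_max_left _ _
    · rw [hsome]
      refine le_max_of_le_right ?_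
      gcongr
      linarith [sq_nonneg (c - conjMean y K x)]
  have hb : BddAbove (range fun act => ∫ t, decisionPayoff q act t ∂(conjecture y K x)) :=
    ⟨_, by rintro _ ⟨act, rfl⟩; exact hle act⟩
  refine le_antisymm (ciSup_le hle) (max_le ?_ ?_)
  · exact hnone.ge.trans (le_ciSup hb none)
  · refine le_trans (le_of_eq ?_) (le_ciSup hb (some (conjMean y K x)))
    rw [hsome]; simp

theorem value_eq {q : ℝ} (hq : 0 < q) (y : ℝ → ℝ) (K : Finset ℝ) :
    value q y K = ∫ x, max 0 (1 - conjVar K x / q) := by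
  simp only [value, iSup_decisionPayoff hq]

/-- The integrand lies in `[0, 1]` and vanishes farther than `q` beyond the extreme known questions.
-/
theorem integrable_max_conjVar {q : ℝ} (hq : 0 < q) (hK : K.Nonempty) :
    Integrable fun x => max 0 (1 - conjVar K x / q) := by
  have hm : Measurable fun x => max 0 (1 - conjVar K x / q) :=
    measurable_const.max (((measurable_conjVar K).div_const q).const_sub 1)
  have hI : Integrable ((Icc (K.min' hK - q) (K.max' hK + q)).indicator fun _ => (1 : ℝ)) :=
    (integrable_indicator_iff measurableSet_Icc).2 (integrableOn_const (by simp))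
  refine hI.mono' hm.aestronglyMeasurable (Filter.Eventually.of_forall fun x => ?_)
  rw [Real.norm_of_nonneg (le_max_left _ _)]
  by_cases hx : x ∈ Icc (K.min' hK - q) (K.max' hK + q)
  · rw [indicator_of_mem hx]
    refine max_le zero_le_one ?_
    have := div_nonneg (conjVar_nonneg K x) hq.le
    linarith
  · rw [indicator_of_notMem hx]
    refine max_le le_rfl ?_
    rw [sub_nonpos, one_le_div hq]
    rcases lt_or_ge x (K.min' hK - q) with h | h
    · rw [conjVar_of_lt_min (K.min'_mem hK) (fun k hk => K.min'_le k hk) (by linarith)]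
      linarith
    · have h2 : K.max' hK + q < x := by
        by_contra h2
        exact hx ⟨h, not_lt.1 h2⟩
      rw [conjVar_of_max_le (K.max'_mem hK) (fun k hk => K.le_max' k hk) (by linarith)]
      linarith

theorem benefit_eq_setIntegral {q : ℝ} (hq : 0 < q) (y : ℝ → ℝ) (hK : K.Nonempty) {E : Set ℝ}
    (hE : MeasurableSet E) (h : ∀ z ∉ E, conjVar (insert x K) z = conjVar K z) :
    benefit q y K x = (∫ z in E, max 0 (1 - conjVar (insert x K) z / q)) -
      ∫ z in E, max 0 (1 - conjVar K z / q) := by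
  have h1 := integral_add_compl hE (integrable_max_conjVar hq (Finset.insert_nonempty x K))
  have h2 := integral_add_compl hE (integrable_max_conjVar hq hK)
  have h3 : ∫ z in Eᶜ, max 0 (1 - conjVar (insert x K) z / q) =
      ∫ z in Eᶜ, max 0 (1 - conjVar K z / q) :=
    setIntegral_congr_fun hE.compl fun z hz => by simp only [h z hz]
  rw [benefit, value_eq hq, value_eq hq, ← h1, ← h2, h3]
  ring

theorem benefit_of_mem {q : ℝ} (y : ℝ → ℝ) (h : x ∈ K) : benefit q y K x = 0 := by
  rw [benefit, Finset.insert_eq_of_mem h, sub_self]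

/-! ### The value of an area -/

/-- Splitting `max 0 r = r + max 0 (-r)` separates the payoff of always acting, `X - X^2/6`, from
the losses that the outside option avoids. -/
theorem integral_max_bridge {X : ℝ} (hX : 0 < X) :
    ∫ t in (0 : ℝ)..X, max 0 (1 - t * (X - t) / X) = areaValue X := by
  have hpoly : ∫ t in (0 : ℝ)..X, (1 - t * (X - t) / X) = X - X ^ 2 / 6 := by
    have : ∀ t : ℝ, 1 - t * (X - t) / X = 1 - t + (1 / X) * t ^ 2 := by intro t; field_simp; ring
    simp only [this]
    rw [intervalIntegral.integral_add (Continuous.intervalIntegrable (by fun_prop) _ _)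
        (Continuous.intervalIntegrable (by fun_prop) _ _),
      intervalIntegral.integral_sub (Continuous.intervalIntegrable (by fun_prop) _ _)
        (Continuous.intervalIntegrable (by fun_prop) _ _),
      intervalIntegral.integral_const_mul]
    simp
    field_simp; ring
  have hmax : ∀ r : ℝ, max 0 r = r + max 0 (-r) := by
    intro r
    rcases le_total 0 r with h | h
    · rw [max_eq_right h, max_eq_left (by linarith)]; ring
    · rw [max_eq_left h, max_eq_right (by linarith)]; ring
  have hc1 : Continuous fun t : ℝ => 1 - t * (X - t) / X := by fun_prop
  have hc2 : Continuous fun t : ℝ => max 0 (-(1 - t * (X - t) / X)) := by fun_prop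
  have hneg : ∫ t in (0 : ℝ)..X, max 0 (-(1 - t * (X - t) / X)) = optionPart X / 6 := by
    rcases le_total X 4 with h | h
    · rw [optionPart_of_le hX.le h, zero_div]
      have : ∀ t : ℝ, max 0 (-(1 - t * (X - t) / X)) = 0 := by
        intro t
        refine max_eq_left ?_
        rw [neg_sub, sub_nonpos, div_le_one hX]
        nlinarith [sq_nonneg (X - 2 * t)]
      simp only [this, intervalIntegral.integral_zero]
    · have h9 := mul_one_sub_rootPart_sq h
      have hs0 := rootPart_nonneg X
      have hs1 := rootPart_lt_one hX
      rw [optionPart_eq h]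
      set s := rootPart X
      -- Here `τ` and `X - τ` are the points where the variance equals `1`; the outside option is
      -- used between them.
      set τ := X * (1 - s) / 2 with hτ
      have hτ0 : 0 ≤ τ := by
        have : 0 ≤ 1 - s := by linarith
        positivity
      have hτ1 : τ ≤ X - τ := by nlinarith
      have hfac : ∀ t : ℝ, -(1 - t * (X - t) / X) = (t - τ) * (X - τ - t) / X := by
        intro t
        rw [eq_div_iff hX.ne']
        have : -(1 - t * (X - t) / X) * X = -X + t * (X - t) := by field_simp; ring
        rw [this, hτ]
        linear_combination (X / 4) * h9
      have i1 : ∫ t in (0 : ℝ)..τ, max 0 (-(1 - t * (X - t) / X)) = 0 := by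
        refine intervalIntegral.integral_zero_ae (Filter.Eventually.of_forall fun t ht => ?_)
        rw [uIoc_of_le hτ0] at ht
        rw [hfac]
        refine max_eq_left (div_nonpos_of_nonpos_of_nonneg ?_ hX.le)
        exact mul_nonpos_of_nonpos_of_nonneg (by linarith [ht.2]) (by linarith [ht.2])
      have i3 : ∫ t in (X - τ)..X, max 0 (-(1 - t * (X - t) / X)) = 0 := by
        refine intervalIntegral.integral_zero_ae (Filter.Eventually.of_forall fun t ht => ?_)
        rw [uIoc_of_le (by linarith)] at ht
        rw [hfac]
        refine max_eq_left (div_nonpos_of_nonpos_of_nonneg ?_ hX.le)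
        exact mul_nonpos_of_nonneg_of_nonpos (by linarith [ht.1]) (by linarith [ht.1])
      have i2 : ∫ t in τ..(X - τ), max 0 (-(1 - t * (X - t) / X)) = X ^ 2 * s ^ 3 / 6 := by
        have hcongr : ∫ t in τ..(X - τ), max 0 (-(1 - t * (X - t) / X)) =
            ∫ t in τ..(X - τ), ((-τ * (X - τ) / X) + t - (1 / X) * t ^ 2) := by
          refine intervalIntegral.integral_congr fun t ht => ?_
          rw [uIcc_of_le hτ1] at ht
          rw [hfac, max_eq_right]
          · field_simp; ring
          · exact div_nonneg (mul_nonneg (by linarith [ht.1]) (by linarith [ht.2])) hX.le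
        rw [hcongr, intervalIntegral.integral_sub (Continuous.intervalIntegrable (by fun_prop) _ _)
        (Continuous.intervalIntegrable (by fun_prop) _ _),
          intervalIntegral.integral_add (Continuous.intervalIntegrable (by fun_prop) _ _)
        (Continuous.intervalIntegrable (by fun_prop) _ _),
          intervalIntegral.integral_const_mul]
        simp only [intervalIntegral.integral_const, integral_id, integral_pow, smul_eq_mul]
        rw [hτ]
        field_simp
        ring
      rw [← intervalIntegral.integral_add_adjacent_intervals (hc2.intervalIntegrable 0 τ)
        (hc2.intervalIntegrable τ X), ← intervalIntegral.integral_add_adjacent_intervals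
        (hc2.intervalIntegrable τ (X - τ)) (hc2.intervalIntegrable (X - τ) X), i1, i2, i3]
      ring
  calc _ = ∫ t in (0 : ℝ)..X, ((1 - t * (X - t) / X) + max 0 (-(1 - t * (X - t) / X))) := by
        refine intervalIntegral.integral_congr fun t _ => ?_
        exact hmax _
    _ = _ := by
        rw [intervalIntegral.integral_add (hc1.intervalIntegrable _ _) (hc2.intervalIntegrable _ _),
          hpoly, hneg, areaValue]

theorem IsArea.setIntegral_eq {q : ℝ} (hq : 0 < q) (h : IsArea K a b) :
    ∫ z in Ico a b, max 0 (1 - conjVar K z / q) = q * areaValue ((b - a) / q) := by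
  have hab := h.2.2.1
  have h1 : ∫ z in Ico a b, max 0 (1 - conjVar K z / q) =
      ∫ z in Ico a b, max 0 (1 - (z - a) / q * ((b - a) / q - (z - a) / q) / ((b - a) / q)) := by
    refine setIntegral_congr_fun measurableSet_Ico fun z hz => ?_
    have : b - a ≠ 0 := by linarith
    simp only [h.conjVar_eq hz.1 hz.2]
    congr 2
    field_simp
    ring
  rw [h1, integral_Ico_eq_integral_Ioc, ← intervalIntegral.integral_of_le hab.le,
    intervalIntegral.integral_comp_sub_right
      (fun u => max 0 (1 - u / q * ((b - a) / q - u / q) / ((b - a) / q))) a,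
    intervalIntegral.integral_comp_div
      (fun u => max 0 (1 - u * ((b - a) / q - u) / ((b - a) / q))) hq.ne', sub_self, zero_div,
    integral_max_bridge (div_pos (by linarith) hq), smul_eq_mul]

/-! ### The benefit of discovering an answer -/

theorem IsArea.insert_left (h : IsArea K a b) (hax : a < x) (hxb : x < b) :
    IsArea (insert x K) a x := by
  refine ⟨Finset.mem_insert_of_mem h.1, Finset.mem_insert_self _ _, hax, fun k hk => ?_⟩
  rcases Finset.mem_insert.1 hk with rfl | hk
  · exact Or.inr le_rfl
  · exact (h.2.2.2 k hk).imp_right fun h' => by linarith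

theorem IsArea.insert_right (h : IsArea K a b) (hax : a < x) (hxb : x < b) :
    IsArea (insert x K) x b := by
  refine ⟨Finset.mem_insert_self _ _, Finset.mem_insert_of_mem h.2.1, hxb, fun k hk => ?_⟩
  rcases Finset.mem_insert.1 hk with rfl | hk
  · exact Or.inl le_rfl
  · exact (h.2.2.2 k hk).imp_left fun h' => by linarith

theorem IsArea.insert_of_le_or_le (h : IsArea K a b) (hx : x ≤ a ∨ b ≤ x) : IsArea (insert x K) a b := by
  refine ⟨Finset.mem_insert_of_mem h.1, Finset.mem_insert_of_mem h.2.1, h.2.2.1, fun k hk => ?_⟩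
  rcases Finset.mem_insert.1 hk with rfl | hk
  · exact hx
  · exact h.2.2.2 k hk

/-- A new question changes the variance only in the part of the line it lies in. -/
theorem conjVar_insert_eq (hK : K.Nonempty)
    (h : ∃ k ∈ K, (x ≤ k ∧ k ≤ z) ∨ (z < k ∧ k ≤ x)) : conjVar (insert x K) z = conjVar K z := by
  obtain ⟨k, hkK, hk⟩ := h
  rcases exists_location hK z with ⟨b, hb, hb', hz⟩ | ⟨a, ha, ha', hz⟩ | ⟨a, b, hA, hz, hz'⟩
  · have hbk := hb' k hkK
    rw [conjVar_of_lt_min hb hb' hz]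
    refine conjVar_of_lt_min (Finset.mem_insert_of_mem hb) (fun j hj => ?_) hz
    rcases Finset.mem_insert.1 hj with rfl | hj
    · rcases hk with hk | hk <;> linarith
    · exact hb' j hj
  · have hka := ha' k hkK
    rw [conjVar_of_max_le ha ha' hz]
    refine conjVar_of_max_le (Finset.mem_insert_of_mem ha) (fun j hj => ?_) hz
    rcases Finset.mem_insert.1 hj with rfl | hj
    · rcases hk with hk | hk <;> linarith
    · exact ha' j hj
  · rw [hA.conjVar_eq hz hz']
    refine (hA.insert_of_le_or_le ?_).conjVar_eq hz hz'
    rcases hA.2.2.2 k hkK with h1 | h1 <;> rcases hk with hk | hk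
    · exact Or.inl (hk.1.trans h1)
    · linarith
    · linarith
    · exact Or.inr (h1.trans hk.2)

theorem IsArea.benefit_eq {q : ℝ} (hq : 0 < q) (y : ℝ → ℝ) (h : IsArea K a b) (hax : a < x)
    (hxb : x < b) : benefit q y K x = q * areaBenefit ((b - a) / q) ((x - a) / q) := by
  have hi := (integrable_max_conjVar hq (Finset.insert_nonempty x K)).integrableOn
    (s := Ico a b)
  rw [benefit_eq_setIntegral hq y ⟨a, h.1⟩ (measurableSet_Ico (a := a) (b := b)), h.setIntegral_eq hq,
    ← Ico_union_Ico_eq_Ico hax.le hxb.le, setIntegral_union Ico_disjoint_Ico_same measurableSet_Ico,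
    (h.insert_left hax hxb).setIntegral_eq hq, (h.insert_right hax hxb).setIntegral_eq hq, areaBenefit,
    ← sub_div, sub_sub_sub_cancel_right]
  · ring
  · exact hi.mono_set (Ico_subset_Ico_right hxb.le)
  · exact hi.mono_set (Ico_subset_Ico_left hax.le)
  · intro z hz
    refine conjVar_insert_eq ⟨a, h.1⟩ ?_
    rcases lt_or_ge z a with hza | hza
    · exact ⟨a, h.1, Or.inr ⟨hza, hax.le⟩⟩
    · exact ⟨b, h.2.1, Or.inl ⟨hxb.le, not_lt.1 fun hzb => hz ⟨hza, hzb⟩⟩⟩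

/-- The rays beyond the old and the new frontier are translates with equal value, so the gain is the
value of the new area alone. -/
theorem benefit_of_max_lt {q : ℝ} (hq : 0 < q) (y : ℝ → ℝ) (ha : a ∈ K) (hk : ∀ k ∈ K, k ≤ a)
    (hax : a < x) : benefit q y K x = q * areaValue ((x - a) / q) := by
  have hx' : ∀ k ∈ insert x K, k ≤ x := by
    intro k hkK
    rcases Finset.mem_insert.1 hkK with rfl | hkK
    · exact le_rfl
    · exact (hk k hkK).trans hax.le
  have hA : IsArea (insert x K) a x := by
    refine ⟨Finset.mem_insert_of_mem ha, Finset.mem_insert_self _ _, hax, fun k hkK => ?_⟩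
    rcases Finset.mem_insert.1 hkK with rfl | hkK
    · exact Or.inr le_rfl
    · exact Or.inl (hk k hkK)
  have hray : ∀ (L : Finset ℝ) (c : ℝ), c ∈ L → (∀ k ∈ L, k ≤ c) →
      ∫ z in Ici c, max 0 (1 - conjVar L z / q) = ∫ z in Ici (0 : ℝ), max 0 (1 - z / q) := by
    intro L c hc hLc
    rw [← integral_indicator measurableSet_Ici, ← integral_indicator measurableSet_Ici,
      ← integral_sub_right_eq_self ((Ici 0).indicator fun z => max 0 (1 - z / q)) c]
    congr 1
    ext z
    by_cases hz : c ≤ z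
    · rw [indicator_of_mem (mem_Ici.2 hz), indicator_of_mem (mem_Ici.2 (sub_nonneg.2 hz)),
        conjVar_of_max_le hc hLc hz]
    · rw [indicator_of_notMem (by simpa using hz), indicator_of_notMem (by simpa using hz)]
  have hi := (integrable_max_conjVar hq (Finset.insert_nonempty x K)).integrableOn (s := Ici a)
  rw [benefit_eq_setIntegral hq y ⟨a, ha⟩ (measurableSet_Ici (a := a)), hray K a ha hk,
    ← Ico_union_Ici_eq_Ici hax.le, setIntegral_union _ measurableSet_Ici, hA.setIntegral_eq hq,
    hray _ x (Finset.mem_insert_self _ _) hx']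
  · ring
  · exact hi.mono_set Ico_subset_Ici_self
  · exact hi.mono_set (Ici_subset_Ici.2 hax.le)
  · exact disjoint_left.2 fun z hz hz' => absurd hz.2 (not_lt.2 hz')
  · intro z hz
    exact conjVar_insert_eq ⟨a, ha⟩ ⟨a, ha, Or.inr ⟨not_le.1 hz, hax.le⟩⟩

theorem benefit_of_lt_min {q : ℝ} (hq : 0 < q) (y : ℝ → ℝ) (hb : b ∈ K) (hk : ∀ k ∈ K, b ≤ k)
    (hxb : x < b) : benefit q y K x = q * areaValue ((b - x) / q) := by
  have hx' : ∀ k ∈ insert x K, x ≤ k := by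
    intro k hkK
    rcases Finset.mem_insert.1 hkK with rfl | hkK
    · exact le_rfl
    · exact hxb.le.trans (hk k hkK)
  have hA : IsArea (insert x K) x b := by
    refine ⟨Finset.mem_insert_self _ _, Finset.mem_insert_of_mem hb, hxb, fun k hkK => ?_⟩
    rcases Finset.mem_insert.1 hkK with rfl | hkK
    · exact Or.inl le_rfl
    · exact Or.inr (hk k hkK)
  have hray : ∀ (L : Finset ℝ) (c : ℝ), c ∈ L → (∀ k ∈ L, c ≤ k) →
      ∫ z in Iio c, max 0 (1 - conjVar L z / q) = ∫ z in Ioi (0 : ℝ), max 0 (1 - z / q) := by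
    intro L c hc hLc
    rw [← integral_indicator measurableSet_Iio, ← integral_indicator measurableSet_Ioi,
      ← integral_sub_left_eq_self ((Ioi 0).indicator fun z => max 0 (1 - z / q)) volume c]
    congr 1
    ext z
    by_cases hz : z < c
    · rw [indicator_of_mem (mem_Iio.2 hz), indicator_of_mem (mem_Ioi.2 (sub_pos.2 hz)),
        conjVar_of_lt_min hc hLc hz]
    · rw [indicator_of_notMem (by simpa using hz), indicator_of_notMem (by simpa using hz)]
  have hi := (integrable_max_conjVar hq (Finset.insert_nonempty x K)).integrableOn (s := Iio b)
  rw [benefit_eq_setIntegral hq y ⟨b, hb⟩ (measurableSet_Iio (a := b)), hray K b hb hk,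
    ← Iio_union_Ico_eq_Iio hxb.le, setIntegral_union _ measurableSet_Ico, hA.setIntegral_eq hq,
    hray _ x (Finset.mem_insert_self _ _) hx']
  · ring
  · exact hi.mono_set (Iio_subset_Iio hxb.le)
  · exact hi.mono_set Ico_subset_Iio_self
  · exact disjoint_left.2 fun z hz hz' => absurd hz'.1 (not_le.2 hz)
  · intro z hz
    exact conjVar_insert_eq ⟨b, hb⟩ ⟨b, hb, Or.inl ⟨hxb.le, not_lt.1 hz⟩⟩

/-! ### Optimal choices of the researcher -/

variable {q : ℝ} {y : ℝ → ℝ}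

/-- The researcher's maximal payoff from question `x` over success probabilities. -/
noncomputable def maxPayoff (q η : ℝ) (y : ℝ → ℝ) (K : Finset ℝ) (x : ℝ) : ℝ :=
  questionPayoff η (benefit q y K x) (conjVar K x)

theorem expands_or_exists_isArea (hK : K.Nonempty) (hx : x ∉ K) :
    Expands K x ∨ ∃ a b, IsArea K a b ∧ a < x ∧ x < b := by
  rcases exists_location hK x with ⟨b, hb, hk, hz⟩ | ⟨a, ha, hk, hz⟩ | ⟨a, b, hA, hz, hz'⟩
  · exact Or.inl (Or.inl fun k hkK => hz.trans_le (hk k hkK))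
  · have : a < x := lt_of_le_of_ne hz fun h => hx (h ▸ ha)
    exact Or.inl (Or.inr fun k hkK => (hk k hkK).trans_lt this)
  · exact Or.inr ⟨a, b, hA, lt_of_le_of_ne hz fun h => hx (h ▸ hA.1), hz'⟩

theorem IsArea.not_expands (h : IsArea K a b) (hax : a < x) (hxb : x < b) : ¬ Expands K x := by
  rintro (hx | hx)
  · linarith [hx a h.1]
  · linarith [hx b h.2.1]

theorem conjVar_pos (hK : K.Nonempty) (hx : x ∉ K) : 0 < conjVar K x := by
  rcases expands_or_exists_isArea hK hx with (h | h) | ⟨a, b, hA, h, h'⟩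
  · have := h _ (K.min'_mem hK)
    rw [conjVar_of_lt_min (K.min'_mem hK) (fun k hk => K.min'_le k hk) this]
    linarith
  · have := h _ (K.max'_mem hK)
    rw [conjVar_of_max_le (K.max'_mem hK) (fun k hk => K.le_max' k hk) this.le]
    linarith
  · rw [hA.conjVar_eq h.le h']
    exact div_pos (mul_pos (by linarith) (by linarith)) (by linarith)

theorem costFactor_erf (t : ℝ) : costFactor (erf t) = ((t ^ 2 : ℝ) : EReal) := by
  rw [costFactor, if_pos (erf_lt_one t), invFun_erf]

theorem researcherPayoff_erf (t : ℝ) : researcherPayoff q η y K x (erf t) =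
    ((erf t * benefit q y K x - η * t ^ 2 * conjVar K x : ℝ) : EReal) := by
  rw [researcherPayoff, costFactor_erf]
  norm_cast
  rw [mul_assoc]

/-- Benefit and variance both vanish, and `⊤ * 0 = 0` covers `ρ = 1`. The optimal probability is
therefore unique only at unknown questions. -/
theorem researcherPayoff_of_mem (hx : x ∈ K) (ρ : ℝ) : researcherPayoff q η y K x ρ = 0 := by
  simp [researcherPayoff, benefit_of_mem y hx, conjVar_of_mem hx]

theorem maxPayoff_of_mem (hx : x ∈ K) : maxPayoff q η y K x = 0 := by
  simp [maxPayoff, questionPayoff, conjVar_of_mem hx]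

theorem researcherPayoff_one (hη : 0 < η) (h : 0 < conjVar K x) :
    researcherPayoff q η y K x 1 = ⊥ := by
  rw [researcherPayoff, costFactor, if_neg (lt_irrefl 1), EReal.top_mul_coe_of_pos h,
    EReal.coe_mul_top_of_pos hη]
  exact EReal.sub_top _

/-- The success probability that is optimal for question `x`. -/
noncomputable def bestProb (q η : ℝ) (y : ℝ → ℝ) (K : Finset ℝ) (x : ℝ) : ℝ :=
  erf (effort η (benefit q y K x / conjVar K x))

theorem bestProb_mem (hη : 0 < η) : bestProb q η y K x ∈ Icc 0 1 :=
  ⟨erf_nonneg (effort_nonneg hη _), (erf_lt_one _).le⟩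

theorem researcherPayoff_bestProb (hK : K.Nonempty) :
    researcherPayoff q η y K x (bestProb q η y K x) = maxPayoff q η y K x := by
  by_cases hx : x ∈ K
  · rw [researcherPayoff_of_mem hx, maxPayoff_of_mem hx, EReal.coe_zero]
  · have hv := conjVar_pos hK hx
    rw [bestProb, researcherPayoff_erf, maxPayoff, questionPayoff, unitPayoff]
    congr 1
    field_simp

theorem researcherPayoff_lt (hη : 0 < η) (hK : K.Nonempty) (hx : x ∉ K) {ρ : ℝ}
    (hρ : ρ ∈ Icc (0 : ℝ) 1) (hne : ρ ≠ bestProb q η y K x) :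
    researcherPayoff q η y K x ρ < maxPayoff q η y K x := by
  have hv := conjVar_pos hK hx
  rcases eq_or_lt_of_le hρ.2 with rfl | h1
  · rw [researcherPayoff_one hη hv]
    exact EReal.bot_lt_coe _
  · obtain ⟨t, ht, rfl⟩ := exists_erf_eq hρ.1 h1
    rw [researcherPayoff_erf, EReal.coe_lt_coe_iff, maxPayoff, questionPayoff]
    have hlt := payoff_lt_unitPayoff hη (r := benefit q y K x / conjVar K x) ht
      fun h => hne (by rw [bestProb, h])
    calc _ = conjVar K x * (benefit q y K x / conjVar K x * erf t - η * t ^ 2) := by field_simp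
      _ < _ := by gcongr

theorem researcherPayoff_le (hη : 0 < η) (hK : K.Nonempty) {ρ : ℝ} (hρ : ρ ∈ Icc (0 : ℝ) 1) :
    researcherPayoff q η y K x ρ ≤ maxPayoff q η y K x := by
  by_cases hx : x ∈ K
  · rw [researcherPayoff_of_mem hx, maxPayoff_of_mem hx, EReal.coe_zero]
  · by_cases h : ρ = bestProb q η y K x
    · rw [h, researcherPayoff_bestProb hK]
    · exact (researcherPayoff_lt hη hK hx hρ h).le

theorem isOptimal_bestProb (hη : 0 < η) (hK : K.Nonempty) {S : Set ℝ} (hx : x ∈ S)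
    (h : ∀ x' ∈ S, maxPayoff q η y K x' ≤ maxPayoff q η y K x) :
    IsOptimal q η y K S x (bestProb q η y K x) := by
  refine ⟨hx, bestProb_mem hη, fun x' hx' ρ' hρ' => ?_⟩
  rw [researcherPayoff_bestProb hK]
  exact (researcherPayoff_le hη hK hρ').trans (EReal.coe_le_coe_iff.2 (h x' hx'))

theorem IsOptimal.maxPayoff_le (hη : 0 < η) (hK : K.Nonempty) {S : Set ℝ} {ρ : ℝ}
    (h : IsOptimal q η y K S x ρ) {x' : ℝ} (hx' : x' ∈ S) :
    maxPayoff q η y K x' ≤ maxPayoff q η y K x := by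
  rw [← EReal.coe_le_coe_iff, ← researcherPayoff_bestProb hK (x := x')]
  exact (h.2.2 x' hx' _ (bestProb_mem hη)).trans (researcherPayoff_le hη hK h.2.1)

theorem IsOptimal.eq_bestProb (hη : 0 < η) (hK : K.Nonempty) {S : Set ℝ} {ρ : ℝ}
    (h : IsOptimal q η y K S x ρ) (hx : x ∉ K) : ρ = bestProb q η y K x := by
  by_contra hne
  have h1 := h.2.2 x h.1 (bestProb q η y K x) (bestProb_mem hη)
  rw [researcherPayoff_bestProb hK] at h1
  exact absurd (researcherPayoff_lt hη hK hx h.2.1 hne) (not_lt.2 h1)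

/-- Homogeneity of degree one transfers the results for `q = 1` to every `q`, since benefit,
variance and length all scale by `q`. -/
theorem questionPayoff_mul (hq : 0 < q) (V v : ℝ) :
    questionPayoff η (q * V) (q * v) = q * questionPayoff η V v := by
  rw [questionPayoff, questionPayoff, mul_div_mul_left _ _ hq.ne', mul_assoc]

theorem IsArea.conjVar_eq_areaVar (hq : 0 < q) (h : IsArea K a b) (hax : a < x) (hxb : x < b) :
    conjVar K x = q * areaVar ((b - a) / q) ((x - a) / q) := by
  have : b - a ≠ 0 := by linarith
  rw [h.conjVar_eq hax.le hxb, areaVar]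
  field_simp
  ring

theorem IsArea.maxPayoff_eq (hq : 0 < q) (h : IsArea K a b) (hax : a ≤ x) (hxb : x < b) :
    maxPayoff q η y K x = q * distancePayoff η ((b - a) / q) ((x - a) / q) := by
  rcases eq_or_lt_of_le hax with rfl | hax
  · simp [maxPayoff_of_mem h.1]
  · rw [maxPayoff, h.benefit_eq hq y hax hxb, h.conjVar_eq_areaVar hq hax hxb,
      questionPayoff_mul hq, distancePayoff]

theorem IsArea.maxPayoff_le (hq : 0 < q) (hη : 0 < η) (h : IsArea K a b) (hax : a < x)
    (hxb : x < b) : maxPayoff q η y K x ≤ q * bestPayoff η ((b - a) / q) := by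
  rw [h.maxPayoff_eq hq hax.le hxb]
  have hX : 0 < (b - a) / q := div_pos (by linarith) hq
  gcongr
  rcases le_total ((x - a) / q) ((b - a) / q / 2) with h1 | h1
  · exact distancePayoff_le_bestPayoff hη hX ⟨div_nonneg (by linarith) hq.le, h1⟩
  -- A question in the right half is reflected to the left half.
  · rw [← distancePayoff_symm]
    refine distancePayoff_le_bestPayoff hη hX ⟨?_, by linarith⟩
    rw [← sub_div]
    exact div_nonneg (by linarith) hq.le

theorem IsArea.exists_maxPayoff_eq (hq : 0 < q) (hη : 0 < η) (h : IsArea K a b) :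
    ∃ x, a < x ∧ x < b ∧ maxPayoff q η y K x = q * bestPayoff η ((b - a) / q) := by
  have hX : 0 < (b - a) / q := div_pos (by linarith [h.2.2.1]) hq
  obtain ⟨d, hd⟩ := exists_isBestDistance hη hX
  have hd0 := (hd.spec hη hX).1
  have hd1 : d < (b - a) / q := by linarith [hd.1.2]
  have h1 : a < a + q * d := by linarith [mul_pos hq hd0]
  have h2 : a + q * d < b := by
    rw [lt_div_iff₀ hq] at hd1
    linarith
  refine ⟨a + q * d, h1, h2, ?_⟩
  rw [h.maxPayoff_eq hq h1.le h2, ← hd.payoff_eq, add_sub_cancel_left, mul_div_cancel_left₀ _ hq.ne']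

theorem Expands.maxPayoff_eq (hq : 0 < q) (hK : K.Nonempty) (h : Expands K x) :
    ∃ d, 0 < d ∧ maxPayoff q η y K x = q * frontierPayoff η d := by
  rcases h with h | h
  · have hx := h _ (K.min'_mem hK)
    have hk : ∀ k ∈ K, K.min' hK ≤ k := fun k hk => K.min'_le k hk
    refine ⟨(K.min' hK - x) / q, div_pos (by linarith) hq, ?_⟩
    rw [maxPayoff, benefit_of_lt_min hq y (K.min'_mem hK) hk hx,
      conjVar_of_lt_min (K.min'_mem hK) hk hx, frontierPayoff, ← questionPayoff_mul hq,
      mul_div_cancel₀ _ hq.ne']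
  · have hx := h _ (K.max'_mem hK)
    have hk : ∀ k ∈ K, k ≤ K.max' hK := fun k hk => K.le_max' k hk
    refine ⟨(x - K.max' hK) / q, div_pos (by linarith) hq, ?_⟩
    rw [maxPayoff, benefit_of_max_lt hq y (K.max'_mem hK) hk hx,
      conjVar_of_max_le (K.max'_mem hK) hk hx.le, frontierPayoff, ← questionPayoff_mul hq,
      mul_div_cancel₀ _ hq.ne']

theorem exists_expands_maxPayoff_eq (hq : 0 < q) (hK : K.Nonempty) {d : ℝ} (hd : 0 < d) :
    ∃ x, Expands K x ∧ maxPayoff q η y K x = q * frontierPayoff η d := by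
  have hk : ∀ k ∈ K, k ≤ K.max' hK := fun k hk => K.le_max' k hk
  have hx : K.max' hK < K.max' hK + q * d := by linarith [mul_pos hq hd]
  refine ⟨K.max' hK + q * d, Or.inr fun k hkK => (hk k hkK).trans_lt hx, ?_⟩
  rw [maxPayoff, benefit_of_max_lt hq y (K.max'_mem hK) hk hx,
    conjVar_of_max_le (K.max'_mem hK) hk hx.le, frontierPayoff, ← questionPayoff_mul hq,
    add_sub_cancel_left, mul_div_cancel_left₀ _ hq.ne']

/-! ### A single area -/

theorem isArea_pair {X : ℝ} (hX : 0 < X) : IsArea {0, X} 0 X := by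
  refine ⟨by simp, by simp, hX, fun k hk => ?_⟩
  rw [Finset.mem_insert, Finset.mem_singleton] at hk
  rcases hk with rfl | rfl
  · exact Or.inl le_rfl
  · exact Or.inr le_rfl

theorem maxPayoff_pair (hq : 0 < q) {X d : ℝ} (hX : 0 < X) (hd : d ∈ Icc 0 (X / 2)) :
    maxPayoff q η y {0, X} d = q * distancePayoff η (X / q) (d / q) := by
  rw [(isArea_pair hX).maxPayoff_eq hq hd.1 (by linarith [hd.2]), sub_zero, sub_zero]

theorem div_mem_Icc_iff (hq : 0 < q) {X d : ℝ} : d / q ∈ Icc 0 (X / q / 2) ↔ d ∈ Icc 0 (X / 2) := by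
  rw [mem_Icc, mem_Icc, div_right_comm, div_le_div_iff_of_pos_right hq, le_div_iff₀ hq, zero_mul]

/-- A best distance has a positive payoff, so it is not an endpoint, and the probability is then
determined. -/
theorem isOptimalInArea_iff (hq : 0 < q) (hη : 0 < η) {X d ρ : ℝ} (hX : 0 < X) :
    IsOptimalInArea q η y X d ρ ↔ IsBestDistance η (X / q) (d / q) ∧
      ρ = erf (effort η (areaBenefit (X / q) (d / q) / areaVar (X / q) (d / q))) := by
  have hK : ({0, X} : Finset ℝ).Nonempty := ⟨0, by simp⟩
  have hX' : 0 < X / q := div_pos hX hq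
  have hA := isArea_pair hX
  have hbp : ∀ d, 0 < d → d < X → bestProb q η y {0, X} d =
      erf (effort η (areaBenefit (X / q) (d / q) / areaVar (X / q) (d / q))) := by
    intro d hd0 hdX
    rw [bestProb, hA.benefit_eq hq y hd0 hdX, hA.conjVar_eq_areaVar hq hd0 hdX,
      mul_div_mul_left _ _ hq.ne', sub_zero, sub_zero]
  have hbest : d ∈ Icc 0 (X / 2) → (∀ d' ∈ Icc 0 (X / 2),
      maxPayoff q η y {0, X} d' ≤ maxPayoff q η y {0, X} d) → IsBestDistance η (X / q) (d / q) := by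
    intro hd hmax
    refine ⟨(div_mem_Icc_iff hq).2 hd, fun e he => ?_⟩
    have he' : q * e ∈ Icc 0 (X / 2) := by
      rw [← div_mem_Icc_iff hq, mul_div_cancel_left₀ _ hq.ne']; exact he
    have := hmax _ he'
    rw [maxPayoff_pair hq hX he', maxPayoff_pair hq hX hd, mul_div_cancel_left₀ _ hq.ne'] at this
    exact le_of_mul_le_mul_left this hq
  have hpos : IsBestDistance η (X / q) (d / q) → 0 < d ∧ d < X ∧ d ∈ Icc 0 (X / 2) := by
    intro h
    have hd := (div_mem_Icc_iff hq).1 h.1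
    have hd0 : 0 < d := by
      have := (h.spec hη hX').1
      rwa [lt_div_iff₀ hq, zero_mul] at this
    exact ⟨hd0, by linarith [hd.2], hd⟩
  constructor
  · intro h
    have hB := hbest h.1 fun d' hd' => IsOptimal.maxPayoff_le hη hK h hd'
    obtain ⟨hd0, hdX, -⟩ := hpos hB
    refine ⟨hB, ?_⟩
    rw [← hbp d hd0 hdX]
    refine IsOptimal.eq_bestProb hη hK h ?_
    simp [hd0.ne', hdX.ne]
  · rintro ⟨hB, rfl⟩
    obtain ⟨hd0, hdX, hd⟩ := hpos hB
    rw [← hbp d hd0 hdX]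
    refine isOptimal_bestProb hη hK hd fun d' hd' => ?_
    rw [maxPayoff_pair hq hX hd', maxPayoff_pair hq hX hd]
    gcongr
    exact hB.2 ((div_mem_Icc_iff hq).2 hd')

theorem areaPayoff_eq (hq : 0 < q) (hη : 0 < η) {X : ℝ} (hX : 0 < X) :
    areaPayoff q η y X = ((q * bestPayoff η (X / q) : ℝ) : EReal) := by
  have hK : ({0, X} : Finset ℝ).Nonempty := ⟨0, by simp⟩
  have hX' : 0 < X / q := div_pos hX hq
  refine le_antisymm ?_ ?_
  · refine iSup₂_le fun d hd => iSup₂_le fun ρ hρ => ?_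
    refine (researcherPayoff_le hη hK hρ).trans (EReal.coe_le_coe_iff.2 ?_)
    rw [maxPayoff_pair hq hX hd]
    gcongr
    exact distancePayoff_le_bestPayoff hη hX' ((div_mem_Icc_iff hq).2 hd)
  · obtain ⟨d, hd⟩ := exists_isBestDistance hη hX'
    have hd' : q * d ∈ Icc 0 (X / 2) := by
      rw [← div_mem_Icc_iff hq, mul_div_cancel_left₀ _ hq.ne']; exact hd.1
    refine le_trans (le_of_eq ?_) (le_iSup₂_of_le (q * d) hd' (le_iSup₂_of_le
      (bestProb q η y {0, X} (q * d)) (bestProb_mem hη) le_rfl))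
    rw [researcherPayoff_bestProb hK, maxPayoff_pair hq hX hd', mul_div_cancel_left₀ _ hq.ne',
      hd.payoff_eq]

/-! ### Expanding knowledge or deepening it -/

/-- There are finitely many areas; the best question in the one with the largest `bestPayoff` beats
the other areas, and the frontier by hypothesis. -/
theorem exists_isMax_of_area (hq : 0 < q) (hη : 0 < η) (hK : K.Nonempty) {W : ℝ} (hW : 0 < W)
    (hWmax : ∀ d, 0 < d → frontierPayoff η d ≤ W)
    (h : ∃ a b, IsArea K a b ∧ W ≤ bestPayoff η ((b - a) / q)) :
    ∃ x, (∀ x', maxPayoff q η y K x' ≤ maxPayoff q η y K x) ∧ ¬ Expands K x := by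
  classical
  obtain ⟨a₀, b₀, hA₀, hW₀⟩ := h
  obtain ⟨p, hp, hmax⟩ := ((K ×ˢ K).filter fun p => IsArea K p.1 p.2).exists_max_image
    (fun p => bestPayoff η ((p.2 - p.1) / q))
    ⟨(a₀, b₀), Finset.mem_filter.2 ⟨Finset.mem_product.2 ⟨hA₀.1, hA₀.2.1⟩, hA₀⟩⟩
  have hA := (Finset.mem_filter.1 hp).2
  have hbest : ∀ a b, IsArea K a b → bestPayoff η ((b - a) / q) ≤
      bestPayoff η ((p.2 - p.1) / q) := fun a b h =>
    hmax (a, b) (Finset.mem_filter.2 ⟨Finset.mem_product.2 ⟨h.1, h.2.1⟩, h⟩)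
  have hWp := hW₀.trans (hbest a₀ b₀ hA₀)
  obtain ⟨x, hx1, hx2, hx⟩ := hA.exists_maxPayoff_eq (y := y) hq hη
  refine ⟨x, fun x' => ?_, hA.not_expands hx1 hx2⟩
  rw [hx]
  by_cases hx' : x' ∈ K
  · rw [maxPayoff_of_mem hx']
    exact (mul_pos hq (hW.trans_le hWp)).le
  · rcases expands_or_exists_isArea hK hx' with h | ⟨a, b, h, h1, h2⟩
    · obtain ⟨d, hd, he⟩ := h.maxPayoff_eq (η := η) (y := y) hq hK
      rw [he]
      have := (hWmax d hd).trans hWp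
      gcongr
    · refine (h.maxPayoff_le hq hη h1 h2).trans ?_
      have := hbest a b h
      gcongr

theorem exists_isMax_of_frontier (hq : 0 < q) (hη : 0 < η) (hK : K.Nonempty) {d : ℝ} (hd : 0 < d)
    (hW : 0 < frontierPayoff η d)
    (hWmax : ∀ d', 0 < d' → frontierPayoff η d' ≤ frontierPayoff η d)
    (h : ∀ a b, IsArea K a b → bestPayoff η ((b - a) / q) ≤ frontierPayoff η d) :
    ∃ x, (∀ x', maxPayoff q η y K x' ≤ maxPayoff q η y K x) ∧ Expands K x := by
  obtain ⟨x, hxE, hx⟩ := exists_expands_maxPayoff_eq (η := η) (y := y) hq hK hd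
  refine ⟨x, fun x' => ?_, hxE⟩
  rw [hx]
  by_cases hx' : x' ∈ K
  · rw [maxPayoff_of_mem hx']
    positivity
  · rcases expands_or_exists_isArea hK hx' with h' | ⟨a, b, h', h1, h2⟩
    · obtain ⟨e, he, he'⟩ := h'.maxPayoff_eq (η := η) (y := y) hq hK
      rw [he']
      have := hWmax e he
      gcongr
    · refine (h'.maxPayoff_le hq hη h1 h2).trans ?_
      have := h a b h'
      gcongr

end Knowledge

/-! ### The proposition for general `q` -/

open Knowledge in
theorem mainTheorem3 (q η : ℝ) (hq : 0 < q) (hη : 0 < η) :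
    ∃ Xhat Xdot Xcheck Xtilde : ℝ,
      Xdot = 8 * Real.cos (Real.pi / 18) / Real.sqrt 3 * q ∧
      2 * q < Xhat ∧ Xhat < Xdot ∧ Xdot < Xcheck ∧ Xcheck < Xtilde ∧ Xtilde < 8 * q ∧
      ∀ y : ℝ → ℝ,
        -- the researcher expands knowledge iff all bounded areas are shorter than `Xhat`
        (∀ K : Finset ℝ, K.Nonempty →
          (∃ x ρ, Knowledge.IsOptimal q η y K Set.univ x ρ) ∧
          ((∀ x ρ, Knowledge.IsOptimal q η y K Set.univ x ρ → Knowledge.Expands K x) ↔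
            ∀ a b, Knowledge.IsArea K a b → b - a < Xhat) ∧
          ((∃ x ρ, Knowledge.IsOptimal q η y K Set.univ x ρ ∧ Knowledge.Expands K x) ↔
            ∀ a b, Knowledge.IsArea K a b → b - a ≤ Xhat)) ∧
        -- the optimal distance and success probability conditional on area length
        (∀ X, 0 < X → ∃ d ρ, Knowledge.IsOptimalInArea q η y X d ρ) ∧
        (∃ ρ, Knowledge.IsOptimalInArea q η y Xtilde (Xtilde / 2) ρ) ∧
        (∀ d ρ : ℝ → ℝ, (∀ X, 0 < X → Knowledge.IsOptimalInArea q η y X (d X) (ρ X)) →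
          (¬ MonotoneOn d (Set.Ioi 0) ∧ ¬ AntitoneOn d (Set.Ioi 0)) ∧
          (¬ MonotoneOn ρ (Set.Ioi 0) ∧ ¬ AntitoneOn ρ (Set.Ioi 0)) ∧
          (∀ X, 0 < X → X ≠ Xdot → ρ X < ρ Xdot) ∧
          (∀ X, 0 < X → X ≠ Xtilde → d X < Xtilde / 2)) ∧
        -- the payoff is single peaked in area length
        StrictMonoOn (Knowledge.areaPayoff q η y) (Set.Ioc 0 Xcheck) ∧
        StrictAntiOn (Knowledge.areaPayoff q η y) (Set.Ici Xcheck) := by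
  obtain ⟨dW, Xh, hdW, hWmax, hW, hXh2, hXhp, hXhe, hXhlt, hXhgt⟩ := exists_expansion_cutoff hη
  obtain ⟨m, hpm, hm, hmono, hanti⟩ := exists_bestPayoff_peak hη
  obtain ⟨Xt, hXt, hXt8, hXtbest, hXtlt⟩ := exists_distance_cutoff hη
  obtain ⟨hp1, hp2⟩ := ratioPeak_bounds
  refine ⟨Xh * q, ratioPeak * q, m * q, Xt * q, rfl, by gcongr, by gcongr, by gcongr,
    mul_lt_mul_of_pos_right (by linarith) hq, by gcongr, fun y => ⟨fun K hK => ?_, ?_, ?_, ?_, ?_, ?_⟩⟩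
  · have hd0 : 0 < dW := by linarith [hdW.1]
    have hlt : ∀ a b, IsArea K a b →
        (b - a < Xh * q ↔ bestPayoff η ((b - a) / q) < frontierPayoff η dW) := by
      intro a b h
      have hX : 0 < (b - a) / q := div_pos (by linarith [h.2.2.1]) hq
      rw [← div_lt_iff₀ hq]
      refine ⟨hXhlt _ hX, fun h1 => ?_⟩
      by_contra h2
      rcases eq_or_lt_of_le (not_lt.1 h2) with h3 | h3
      · rw [← h3, hXhe] at h1; exact lt_irrefl _ h1
      · exact lt_asymm h1 (hXhgt _ h3)
    have hle : ∀ a b, IsArea K a b →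
        (b - a ≤ Xh * q ↔ bestPayoff η ((b - a) / q) ≤ frontierPayoff η dW) := by
      intro a b h
      have hX : 0 < (b - a) / q := div_pos (by linarith [h.2.2.1]) hq
      rw [← div_le_iff₀ hq]
      refine ⟨fun h1 => ?_, fun h1 => ?_⟩
      · rcases eq_or_lt_of_le h1 with h3 | h3
        · rw [h3, hXhe]
        · exact (hXhlt _ hX h3).le
      · by_contra h2
        exact absurd (hXhgt _ (not_le.1 h2)) (not_lt.2 h1)
    have hopt : ∀ x, (∀ x', maxPayoff q η y K x' ≤ maxPayoff q η y K x) →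
        IsOptimal q η y K univ x (bestProb q η y K x) := fun x hx =>
      isOptimal_bestProb hη hK (mem_univ x) fun x' _ => hx x'
    obtain ⟨xE, hxE, hxEe⟩ := exists_expands_maxPayoff_eq (η := η) (y := y) hq hK hd0
    refine ⟨?_, ⟨fun h a b hA => ?_, fun h x ρ hx => ?_⟩, ⟨?_, fun h => ?_⟩⟩
    · by_cases h : ∃ a b, IsArea K a b ∧ frontierPayoff η dW ≤ bestPayoff η ((b - a) / q)
      · obtain ⟨x, hx, -⟩ := exists_isMax_of_area (y := y) hq hη hK hW hWmax h
        exact ⟨x, _, hopt x hx⟩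
      · push Not at h
        obtain ⟨x, hx, -⟩ := exists_isMax_of_frontier (y := y) hq hη hK hd0 hW hWmax
          fun a b hA => (h a b hA).le
        exact ⟨x, _, hopt x hx⟩
    · rw [hlt a b hA]
      by_contra hcon
      obtain ⟨x, hx, hxn⟩ := exists_isMax_of_area (y := y) hq hη hK hW hWmax
        ⟨a, b, hA, not_lt.1 hcon⟩
      exact hxn (h x _ (hopt x hx))
    -- An optimal question pays at least the positive frontier maximum, so it is not already known
    -- and cannot lie in an area below the cutoff.
    · have h1 := hx.maxPayoff_le hη hK (mem_univ xE)
      rw [hxEe] at h1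
      have hxK : x ∉ K := fun hxK => by
        rw [maxPayoff_of_mem hxK] at h1
        exact absurd (mul_pos hq hW) (not_lt.2 h1)
      refine (expands_or_exists_isArea hK hxK).resolve_right ?_
      rintro ⟨a, b, hA, ha, hb⟩
      have h2 := le_of_mul_le_mul_left (h1.trans (hA.maxPayoff_le hq hη ha hb)) hq
      exact absurd ((hlt a b hA).1 (h a b hA)) (not_lt.2 h2)
    · rintro ⟨x, ρ, hx, hxE'⟩ a b hA
      rw [hle a b hA]
      obtain ⟨x', -, -, hx'⟩ := hA.exists_maxPayoff_eq (y := y) hq hη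
      obtain ⟨d, hd, he⟩ := hxE'.maxPayoff_eq (η := η) (y := y) hq hK
      have h1 := hx.maxPayoff_le hη hK (mem_univ x')
      rw [hx', he] at h1
      exact (le_of_mul_le_mul_left h1 hq).trans (hWmax d hd)
    · obtain ⟨x, hx, hxE'⟩ := exists_isMax_of_frontier (y := y) hq hη hK hd0 hW hWmax
        fun a b hA => (hle a b hA).1 (h a b hA)
      exact ⟨x, _, hopt x hx, hxE'⟩
  · intro X hX
    obtain ⟨d, hd⟩ := exists_isBestDistance hη (div_pos hX hq)
    refine ⟨q * d, _, (isOptimalInArea_iff hq hη hX).2 ⟨?_, rfl⟩⟩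
    rwa [mul_div_cancel_left₀ _ hq.ne']
  · refine ⟨_, (isOptimalInArea_iff hq hη (mul_pos (by linarith) hq)).2 ⟨?_, rfl⟩⟩
    rwa [div_right_comm, mul_div_cancel_right₀ _ hq.ne']
  · intro d ρ hdρ
    have hB : ∀ X, 0 < X → IsBestDistance η (X / q) (d X / q) := fun X hX =>
      ((isOptimalInArea_iff hq hη hX).1 (hdρ X hX)).1
    have hR : ∀ X, 0 < X → ρ X = erf (effort η (areaBenefit (X / q) (d X / q) /
        areaVar (X / q) (d X / q))) := fun X hX => ((isOptimalInArea_iff hq hη hX).1 (hdρ X hX)).2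
    have hhalf : ∀ X, 0 < X → X ≤ 36 / 5 → d (X * q) = X / 2 * q := by
      intro X h0 hX
      have h := hB (X * q) (mul_pos h0 hq)
      rw [mul_div_cancel_right₀ _ hq.ne'] at h
      have := h.eq_half hη h0 hX
      rwa [div_eq_iff hq.ne'] at this
    have hpk0 : 0 < ratioPeak * q := mul_pos (by linarith) hq
    have hρmax : ∀ X, 0 < X → X ≠ ratioPeak * q → ρ X < ρ (ratioPeak * q) := by
      intro X hX hne
      rw [hR X hX, hR _ hpk0]
      have h1 := hB X hX
      have h2 := hB _ hpk0
      have hX' := div_pos hX hq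
      have hs := h1.spec hη hX'
      rw [mul_div_cancel_right₀ _ hq.ne'] at h2 ⊢
      rw [h2.ratio_eq hη]
      have h3 := h1.ratio_lt hη hX' fun h => hne (by rwa [div_eq_iff hq.ne'] at h)
      have h4 := div_pos hs.2.1 hs.2.2
      exact erf_strictMono (effort_strictMonoOn hη h4.le (h4.trans h3).le h3)
    have hdmax : ∀ X, 0 < X → X ≠ Xt * q → d X < Xt * q / 2 := by
      intro X hX hne
      have h1 := hB X hX
      rcases lt_or_gt_of_ne hne with h | h
      · have := ((div_mem_Icc_iff hq).1 h1.1).2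
        linarith
      · have h2 := hXtlt (X / q) (d X / q) (by rwa [lt_div_iff₀ hq]) h1
        rw [div_lt_iff₀ hq] at h2
        nlinarith
    -- The distance is `18/5 * q` at length `36/5 * q` but smaller at `9 * q`, and it rises from `q`
    -- to `2 * q`. The probability is compared at its strict peak with lengths `9 * q` and `q`.
    refine ⟨⟨fun hmon => ?_, fun hant => ?_⟩, ⟨fun hmon => ?_, fun hant => ?_⟩, hρmax, hdmax⟩
    · have h1 := hmon (show 36 / 5 * q ∈ Ioi 0 from mul_pos (by norm_num) hq)
        (show 9 * q ∈ Ioi 0 from mul_pos (by norm_num) hq) (by nlinarith)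
      rw [hhalf _ (by norm_num) le_rfl] at h1
      have h2 := hB (9 * q) (mul_pos (by norm_num) hq)
      rw [mul_div_cancel_right₀ _ hq.ne'] at h2
      have h3 := hXtlt 9 _ (by linarith) h2
      rw [div_lt_iff₀ hq] at h3
      linarith
    · have h1 := hant (show 1 * q ∈ Ioi 0 from mul_pos (by norm_num) hq)
        (show 2 * q ∈ Ioi 0 from mul_pos (by norm_num) hq) (by nlinarith)
      rw [hhalf _ (by norm_num) (by norm_num), hhalf _ (by norm_num) (by norm_num)] at h1
      linarith
    · have h9 : 0 < 9 * q := by positivity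
      have h1 := hmon hpk0 h9 (by nlinarith)
      exact absurd (hρmax _ h9 (by nlinarith)) (not_lt.2 h1)
    · have h1 := hant (show q ∈ Ioi 0 from hq) hpk0 (by nlinarith)
      exact absurd (hρmax _ hq (by nlinarith)) (not_lt.2 h1)
  · intro X hX Y hY hXY
    rw [areaPayoff_eq hq hη hX.1, areaPayoff_eq hq hη hY.1, EReal.coe_lt_coe_iff]
    refine mul_lt_mul_of_pos_left (hmono ⟨div_pos hX.1 hq, ?_⟩ ⟨div_pos hY.1 hq, ?_⟩ ?_) hq
    · rw [div_le_iff₀ hq]; exact hX.2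
    · rw [div_le_iff₀ hq]; exact hY.2
    · gcongr
  · intro X hX Y hY hXY
    have hm0 : 0 < m * q := mul_pos (by linarith) hq
    rw [areaPayoff_eq hq hη (hm0.trans_le hX), areaPayoff_eq hq hη (hm0.trans_le hY),
      EReal.coe_lt_coe_iff]
    refine mul_lt_mul_of_pos_left (hanti ?_ ?_ ?_) hq
    · rw [mem_Ici, le_div_iff₀ hq]; exact hX
    · rw [mem_Ici, le_div_iff₀ hq]; exact hY
    · gcongr
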